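/- Let $q$ be a prime power, $r\ge 1$ an integer with $r\mid q-1$, and $p$ a prime with $p\mid (q-1)/r$. For an integer $b\ge 1$ put $m=p^b$ and $$n=\Phi_{p^b}(q)=\frac{q^{p^b}-1}{q^{p^{b-1}}-1},\qquad nr=\frac{q^{m}-1}{s},$$ where $s$ is a positive integer. Represent residues modulo $nr$ by $1,2,\dots,nr$, let $Z_{n,r}=\{1+ir: 0\le i\le n-1\}$, and for $i\in Z_{n,r}$ let $C_i=\{iq^j \bmod nr: j\ge 0\}$ be its $q$-cyclotomic coset modulo $nr$, whose smallest element is its coset leader. Let $N_l$ be the number of cosets of size $l$ in $Z_{n,r}$, ordered by their leaders. Then $$\{|C_i|: i\in Z_{n,r}\}=\{1,p^b\},\qquad N_1=p,\qquad N_{p^b}=\frac{n-p}{p^b}.$$ Let $\beta$ be a primitive $nr$-th root of unity in an algebraic closure of $\mathbb F_q$ (one exists) and let $\lambda=\beta^n$, an element of $\mathbb F_q$ of multiplicative order $r$. For a union $T$ of cosets in $Z_{n,r}$, let $\mathcal C_T$ be the $\lambda$-constacyclic code of length $n$ over $\mathbb F_q$ with generator polynomial $\prod_{j\in T}(x-\beta^j)$,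 i.e. with defining set $T$ with respect to $\beta$. (1) If $T$ is the union of the first $\lceil N_1/2\rceil$ cosets of size $1$ and the first $\lceil N_{p^b}/2\rceil$ cosets of size $p^b$, then $\mathcal C_T$ has parameters $$\left[n,\ n-\left\lceil \frac p2\right\rceil-p^b\left\lceil\frac{n-p}{2p^b}\right\rceil,\ \ge \left\lceil\frac{q\lceil (n-p)/(2p^b)\rceil}{q-1}\right\rceil+\Lambda_{p^b}\right],$$ where $\Lambda_m=\left\lceil \frac{q|S_m|}{q-1}\right\rceil-1$ and $S_m$ is the set of all triples $(i,j,t)$ of integers with $$\tfrac{m+1}{2}\le i\le \lfloor m-\log_q(s+1)\rfloor,\quad 1\le j\le q-1,\quad 0\le t<\frac{q^i-j(q^{m-i}-1)-1}{q^{m-i+1}-q},$$ $$q^i+qt+j\equiv 1 \pmod r,\qquad q^i+qt+j\le 1+\left(\left\lceil \frac{q\lceil N_m/2\rceil}{q-1}\right\rceil-2\right)r .$$ (2) If $r\le 3$ or $2p^b(q-1)\ge qr$, and $T$ is the union of the first $\lfloor N_1/2\rfloor$ cosets of size $1$ and the first $\lfloor N_{p^b}/2\rfloor$ cosets of size $p^b$,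 then $\mathcal C_T$ has parameters $$\left[n,\ n-\left\lfloor \frac p2\right\rfloor-p^b\left\lfloor\frac{n-p}{2p^b}\right\rfloor,\ \ge \left\lfloor\frac{q(n-p)}{2p^b(q-1)}\right\rfloor\right].$$ For fixed $q,r,p$, infinitely many lengths $n$ occur as $b$ varies, so these are infinite families of codes. -/

import Mathlib

open Polynomial

noncomputable section

namespace Constacyclic

/-! ### Cyclotomic cosets. Residues modulo `N` are represented by `1, 2, …, N`. -/

open Classical in
/-- The `q`-cyclotomic coset of `i` modulo `N`, as a subset of `{1, …, N}`. -/
def coset (q N i : ℕ) : Finset ℕ :=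
  (Finset.Icc 1 N).filter fun x => ∃ j : ℕ, x ≡ i * q ^ j [MOD N]

/-- `Z_{n,r} = {1 + i r : 0 ≤ i ≤ n - 1}`. -/
def Z (n r : ℕ) : Finset ℕ := (Finset.range n).image fun i => 1 + i * r

/-- `N_l`: the number of `q`-cyclotomic cosets modulo `n r` of size `l` of elements of `Z_{n,r}`. -/
def numCosets (q n r l : ℕ) : ℕ :=
  (((Z n r).image (coset q (n * r))).filter fun c => c.card = l).card

open Classical in
/-- The coset leaders in `Z_{n,r}` (smallest elements of their cosets) of the cosets of size `l`. -/
def leaders (q n r l : ℕ) : Finset ℕ :=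
  (Z n r).filter fun i =>
    (coset q (n * r) i).card = l ∧ ∀ x ∈ coset q (n * r) i, i ≤ x

/-- The `k` smallest coset leaders in `Z_{n,r}` of cosets of size `l` (all of them if there are
fewer than `k`). -/
def firstLeaders (q n r l k : ℕ) : Finset ℕ :=
  (leaders q n r l).filter fun i => ((leaders q n r l).filter fun x => x < i).card < k

/-- Leaders of the first `⌈N_l/2⌉` cosets of size `l` and the first `⌈N_m/2⌉` of size `m`. -/
def ceilLeaders (q n r l m : ℕ) : Finset ℕ :=
  firstLeaders q n r l ⌈(numCosets q n r l : ℚ) / 2⌉₊ ∪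
    firstLeaders q n r m ⌈(numCosets q n r m : ℚ) / 2⌉₊

/-- Leaders of the first `⌊N_l/2⌋` cosets of size `l` and the first `⌊N_m/2⌋` of size `m`. -/
def floorLeaders (q n r l m : ℕ) : Finset ℕ :=
  firstLeaders q n r l ⌊(numCosets q n r l : ℚ) / 2⌋₊ ∪
    firstLeaders q n r m ⌊(numCosets q n r m : ℚ) / 2⌋₊

/-- The union of the cosets with leaders in `L`. -/
def cosetUnion (q n r : ℕ) (L : Finset ℕ) : Finset ℕ :=
  L.biUnion (coset q (n * r))

/-! ### The correction term `Λ_m` -/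

/-- The number `s` with `n r = (q ^ m - 1) / s`, when `n r ∣ q ^ m - 1`. -/
def cofactor (q n r m : ℕ) : ℕ := (q ^ m - 1) / (n * r)

/-- The set `S_m` of triples `(i, j, t)`. -/
def S (q n r m : ℕ) : Set (ℕ × ℕ × ℕ) :=
  {x | match x with
    | (i, j, t) =>
      ((m : ℚ) + 1) / 2 ≤ i ∧
      (i : ℤ) ≤ ⌊(m : ℝ) - Real.logb q ((cofactor q n r m : ℝ) + 1)⌋ ∧
      1 ≤ j ∧ j ≤ q - 1 ∧
      (t : ℚ) < ((q : ℚ) ^ i - j * ((q : ℚ) ^ (m - i) - 1) - 1) / ((q : ℚ) ^ (m - i + 1) - q) ∧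
      q ^ i + q * t + j ≡ 1 [MOD r] ∧
      ((q ^ i + q * t + j : ℕ) : ℤ) ≤
        1 + (⌈(q : ℚ) * (⌈(numCosets q n r m : ℚ) / 2⌉ : ℤ) / ((q : ℚ) - 1)⌉ - 2) * (r : ℤ)}

/-- `Λ_m = ⌈q |S_m| / (q - 1)⌉ - 1`, an integer. -/
def Lam (q n r m : ℕ) : ℤ :=
  ⌈(q : ℚ) * ((S q n r m).ncard : ℚ) / ((q : ℚ) - 1)⌉ - 1

/-! ### Linear and constacyclic codes -/

variable {F : Type*} [Field F]

open Classical in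
/-- Minimum distance of a linear code: the least Hamming distance of two distinct codewords
(and `0` for the zero code). -/
def minDist {n : ℕ} (C : Submodule F (Fin n → F)) : ℕ :=
  sInf {d | ∃ x ∈ C, ∃ y ∈ C, x ≠ y ∧ hammingDist x y = d}

/-- `(c_0, …, c_{n-1}) ↦ (a c_{n-1}, c_0, …, c_{n-2})`. -/
def shift {n : ℕ} (a : F) (c : Fin n → F) : Fin n → F := fun i =>
  if (i : ℕ) = 0 then a * c ⟨n - 1, by have := i.2; omega⟩
  else c ⟨(i : ℕ) - 1, by have := i.2; omega⟩

/-- A linear code is `a`-constacyclic if it is closed under the `a`-constacyclic shift. -/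
def IsConstacyclic {n : ℕ} (a : F) (C : Submodule F (Fin n → F)) : Prop :=
  ∀ c ∈ C, shift a c ∈ C

/-- `F^n → F[x]/(x^n - a)`, `(c_0, …, c_{n-1}) ↦ c_0 + c_1 x + ⋯ + c_{n-1} x^{n-1}`. -/
def phi (n : ℕ) (a : F) : (Fin n → F) →ₗ[F] AdjoinRoot (X ^ n - C a : F[X]) :=
  Fintype.linearCombination F fun i : Fin n =>
    (AdjoinRoot.root (X ^ n - C a : F[X])) ^ (i : ℕ)

/-- The code of length `n` corresponding to the ideal of `F[x]/(x^n - a)` generated by `g`. -/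
def codeOf (n : ℕ) (a : F) (g : F[X]) : Submodule F (Fin n → F) :=
  Submodule.comap (phi n a)
    ((Ideal.span {AdjoinRoot.mk (X ^ n - C a : F[X]) g}).restrictScalars F)

/-- The product of the minimal polynomials over `F` of `β ^ i`, `i ∈ L`. -/
def genPoly (β : AlgebraicClosure F) (L : Finset ℕ) : F[X] :=
  ∏ i ∈ L, minpoly F (β ^ i)

open Classical in
/-- The elements `i` of `Z_{n,r}` with `g(β ^ i) = 0`: the defining set, with respect to `β`, of
the code generated by a divisor `g` of `x^n - β^n`. -/
def definingSet (n r : ℕ) (β : AlgebraicClosure F) (g : F[X]) : Finset ℕ :=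
  (Z n r).filter fun i => aeval (β ^ i) g = 0

/-- The polynomial `genPoly β L` generates an `a`-constacyclic `[n, k, ≥ d]` code, whose defining
set with respect to `β` is the union of the cosets with leaders in `L`. -/
def Generates (q n r : ℕ) (a : F) (β : AlgebraicClosure F) (L : Finset ℕ) (k d : ℤ) : Prop :=
  genPoly β L ∣ X ^ n - C a ∧
  definingSet n r β (genPoly β L) = cosetUnion q n r L ∧
  IsConstacyclic a (codeOf n a (genPoly β L)) ∧
  (Module.finrank F (codeOf n a (genPoly β L)) : ℤ) = k ∧
  d ≤ (minDist (codeOf n a (genPoly β L)) : ℤ)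

end Constacyclic

end

noncomputable section

namespace Constacyclic

/-! ### Cyclotomic cosets -/

section Cosets

variable {q N m n r x y l k : ℕ}

/-! Write the exponent as `b + 1`, with `m = p ^ (b + 1)` and `Q = q ^ p ^ b`, so that `n = 1 + Q +
⋯ + Q ^ (p - 1)`.

Coset sizes. Since `Q - 1 = r p s'` and `n ≡ p` modulo `Q - 1`, one gets `n = p w` with `w ≡ 1`
modulo `s' r`; thus `w` is prime to `r` and `s'`. Being fixed by `Q` modulo `n r` then means
divisibility by `w`, and this already forces being fixed by `q`. As sizes divide the prime power
`m`, only `1` and `m` occur. The multiples of `w` in `Z n r` form one class of indices modulo `w`,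
which gives `p` singletons, evenly spaced (`IsLength.exists_quotient`, `IsLength.card_fixed`).

Distance. The BCH bound (`lt_hammingNorm`) gives distance above `K` once the defining set contains
the first `K` elements of `Z n r`. Two conditions suffice. The even spacing covers the singletons if
`p K ≤ n h₁`, where `h₁` singletons are chosen. The chosen `h` cosets of size `m` suffice if at most
`h` leaders of size `m` lie among those `K` elements. Leaders are sparse: no multiple of `q` is a
leader, nor is any number coming from `S_m`. This leaves at most `K - ⌊K / q⌋ - |S_m|` leaders when
those numbers lie among the first `K` (`IsLength.card_leaders_add_card_le`). The factor `q / (q -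
1)` and the term `Λ_m` come from solving this for `K`.

Dimension. The generator polynomial has the defining set as its simple roots, so the dimension is
`n` minus the number of chosen residues. -/

lemma mem_coset : x ∈ coset q N y ↔ (1 ≤ x ∧ x ≤ N) ∧ ∃ j : ℕ, x ≡ y * q ^ j [MOD N] := by
  simp [coset]

lemma self_mem_coset (hx : 1 ≤ x ∧ x ≤ N) : x ∈ coset q N x :=
  mem_coset.2 ⟨hx, 0, by simp [Nat.ModEq.refl]⟩

lemma mem_coset_trans {z : ℕ} (hyx : y ∈ coset q N x) (hzy : z ∈ coset q N y) :
    z ∈ coset q N x := by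
  obtain ⟨-, j, hj⟩ := mem_coset.1 hyx
  obtain ⟨hz, k, hk⟩ := mem_coset.1 hzy
  refine mem_coset.2 ⟨hz, j + k, hk.trans ?_⟩
  rw [pow_add, ← mul_assoc]
  exact hj.mul_right _

/-- Multiplication by `q ^ j` is undone by `q ^ (j * (m - 1))`, because `q ^ m ≡ 1`. -/
lemma mem_coset_symm (hm : q ^ m ≡ 1 [MOD N]) (hm0 : 0 < m) (hx : 1 ≤ x ∧ x ≤ N)
    (h : y ∈ coset q N x) : x ∈ coset q N y := by
  obtain ⟨-, j, hj⟩ := mem_coset.1 h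
  refine mem_coset.2 ⟨hx, j * (m - 1), ((hj.mul_right _).trans ?_).symm⟩
  have e : x * q ^ j * q ^ (j * (m - 1)) = x * (q ^ m) ^ j := by
    rw [mul_assoc, ← pow_add, ← pow_mul]
    congr 2
    obtain ⟨k, rfl⟩ := Nat.exists_eq_succ_of_ne_zero hm0.ne'
    simp; ring
  rw [e]
  simpa using (hm.pow j).mul_left x

lemma coset_eq_of_mem (hm : q ^ m ≡ 1 [MOD N]) (hm0 : 0 < m) (hx : 1 ≤ x ∧ x ≤ N)
    (h : y ∈ coset q N x) : coset q N y = coset q N x := by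
  ext z
  exact ⟨mem_coset_trans h, mem_coset_trans (mem_coset_symm hm hm0 hx h)⟩

lemma eq_of_modEq (hx : 1 ≤ x ∧ x ≤ N) (hy : 1 ≤ y ∧ y ≤ N) (h : x ≡ y [MOD N]) : x = y := by
  have h1 : x - 1 ≡ y - 1 [MOD N] := by
    apply Nat.ModEq.add_right_cancel' 1
    rwa [Nat.sub_add_cancel hx.1, Nat.sub_add_cancel hy.1]
  have := Nat.ModEq.eq_of_lt_of_lt h1 (by omega) (by omega)
  omega

lemma exists_modEq (hN : 0 < N) (z : ℕ) : ∃ y, (1 ≤ y ∧ y ≤ N) ∧ y ≡ z [MOD N] := by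
  rcases Nat.eq_zero_or_pos (z % N) with h | h
  · refine ⟨N, ⟨hN, le_rfl⟩, ?_⟩
    simp [Nat.ModEq, h]
  · exact ⟨z % N, ⟨h, (Nat.mod_lt _ hN).le⟩, Nat.mod_modEq _ _⟩

lemma iterate_mul_right (q N j : ℕ) (z : ZMod N) : (fun y : ZMod N => y * q)^[j] z = z * q ^ j := by
  induction j with
  | zero => simp
  | succ j ih => rw [Function.iterate_succ_apply', ih, pow_succ, mul_assoc]

/-- The size of the coset of `x` is the period of `x` under multiplication by `q`. -/
lemma card_coset (hN : 0 < N) (hm : q ^ m ≡ 1 [MOD N]) (hm0 : 0 < m) :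
    (coset q N x).card = Function.minimalPeriod (fun y : ZMod N => y * q) (x : ZMod N) := by
  classical
  set f : ZMod N → ZMod N := fun y => y * q with hf
  have hper : Function.IsPeriodicPt f m (x : ZMod N) := by
    rw [Function.IsPeriodicPt, Function.IsFixedPt, hf, iterate_mul_right]
    have := (ZMod.natCast_eq_natCast_iff _ _ _).2 hm
    push_cast at this
    rw [this, mul_one]
  have hinj : Set.InjOn (fun z : ℕ => (z : ZMod N)) (coset q N x) := by
    intro a ha b hb hab
    exact eq_of_modEq (mem_coset.1 ha).1 (mem_coset.1 hb).1
      ((ZMod.natCast_eq_natCast_iff _ _ _).1 hab)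
  -- In `ZMod N` the coset becomes the orbit of `x`, listed without repetition by exponents below
  -- the period.
  have himg : (coset q N x).image (fun z : ℕ => (z : ZMod N))
      = (Finset.range (Function.minimalPeriod f (x : ZMod N))).image fun j => f^[j] (x : ZMod N) := by
    ext z
    simp only [Finset.mem_image, Finset.mem_range]
    constructor
    · rintro ⟨a, ha, rfl⟩
      obtain ⟨-, j, hj⟩ := mem_coset.1 ha
      refine ⟨j % Function.minimalPeriod f (x : ZMod N),
        Nat.mod_lt _ (hper.minimalPeriod_pos hm0), ?_⟩
      rw [Function.iterate_mod_minimalPeriod_eq, hf, iterate_mul_right,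
        (ZMod.natCast_eq_natCast_iff _ _ _).2 hj]
      push_cast; rfl
    · rintro ⟨j, -, rfl⟩
      obtain ⟨a, ha, haj⟩ := exists_modEq hN (x * q ^ j)
      refine ⟨a, mem_coset.2 ⟨ha, j, haj⟩, ?_⟩
      rw [(ZMod.natCast_eq_natCast_iff _ _ _).2 haj, hf, iterate_mul_right]
      push_cast; rfl
  rw [← Finset.card_image_of_injOn hinj, himg, Finset.card_image_of_injOn, Finset.card_range]
  intro a ha b hb hab
  exact Function.iterate_injOn_Iio_minimalPeriod (by simpa using ha) (by simpa using hb) hab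

lemma card_coset_eq_one_iff (hN : 0 < N) (hm : q ^ m ≡ 1 [MOD N]) (hm0 : 0 < m) :
    (coset q N x).card = 1 ↔ x * q ≡ x [MOD N] := by
  rw [card_coset hN hm hm0, Function.minimalPeriod_eq_one_iff_isFixedPt, Function.IsFixedPt,
    ← ZMod.natCast_eq_natCast_iff]
  push_cast; rfl

/-- If the elements fixed by `q ^ p ^ b` are fixed by `q`, and `q ^ p ^ (b + 1)` fixes everything,
then every coset has size `1` or `p ^ (b + 1)`. -/
lemma card_coset_eq_one_or {p b : ℕ} (hp : p.Prime) (hN : 0 < N)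
    (hm : q ^ p ^ (b + 1) ≡ 1 [MOD N])
    (hfix : x * q ^ p ^ b ≡ x [MOD N] → x * q ≡ x [MOD N]) :
    (coset q N x).card = 1 ∨ (coset q N x).card = p ^ (b + 1) := by
  have hm0 : 0 < p ^ (b + 1) := pow_pos hp.pos _
  by_cases h1 : x * q ≡ x [MOD N]
  · exact Or.inl ((card_coset_eq_one_iff hN hm hm0).2 h1)
  right
  have hper : Function.minimalPeriod (fun y : ZMod N => y * q) (x : ZMod N) ∣ p ^ (b + 1) := by
    apply Function.IsPeriodicPt.minimalPeriod_dvd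
    rw [Function.IsPeriodicPt, Function.IsFixedPt, iterate_mul_right]
    have := (ZMod.natCast_eq_natCast_iff _ _ _).2 hm
    push_cast at this
    rw [this, mul_one]
  rw [card_coset hN hm hm0]
  obtain ⟨c, hc, hpc⟩ := (Nat.dvd_prime_pow hp).1 hper
  rw [hpc]
  rcases hc.eq_or_lt with rfl | hc
  · rfl
  -- A proper divisor of `p ^ (b + 1)` divides `p ^ b`, so `x` would be fixed by `q ^ p ^ b`, hence
  -- by `q`.
  exfalso
  apply h1
  apply hfix
  have h2 : Function.IsPeriodicPt (fun y : ZMod N => y * q) (p ^ b) (x : ZMod N) := by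
    rw [Function.isPeriodicPt_iff_minimalPeriod_dvd, hpc]
    exact pow_dvd_pow _ (by omega)
  rw [Function.IsPeriodicPt, Function.IsFixedPt, iterate_mul_right] at h2
  apply (ZMod.natCast_eq_natCast_iff _ _ _).1
  push_cast
  exact h2

lemma mem_Z : x ∈ Z n r ↔ ∃ k < n, x = 1 + k * r := by
  simp [Z, eq_comm]

lemma bounds_of_mem_Z (hr : 0 < r) (h : x ∈ Z n r) : 1 ≤ x ∧ x ≤ n * r := by
  obtain ⟨k, hk, rfl⟩ := mem_Z.1 h
  refine ⟨by omega, ?_⟩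
  have := Nat.mul_le_mul_right r (Nat.succ_le_of_lt hk)
  rw [Nat.succ_mul] at this
  omega

lemma mem_Z_iff (hr : 0 < r) : x ∈ Z n r ↔ (1 ≤ x ∧ x ≤ n * r) ∧ x ≡ 1 [MOD r] := by
  constructor
  · intro h
    refine ⟨bounds_of_mem_Z hr h, ?_⟩
    obtain ⟨k, hk, rfl⟩ := mem_Z.1 h
    simp [Nat.ModEq]
  · rintro ⟨⟨h1, h2⟩, h⟩
    obtain ⟨k, hk⟩ := (Nat.modEq_iff_dvd' h1).1 h.symm
    have hx : x = 1 + k * r := by rw [mul_comm] at hk; omega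
    refine mem_Z.2 ⟨k, ?_, hx⟩
    by_contra hkn
    have := Nat.mul_le_mul_right r (not_lt.1 hkn)
    omega

lemma card_Z (hr : 0 < r) : (Z n r).card = n := by
  rw [Z, Finset.card_image_of_injective, Finset.card_range]
  intro a b h
  exact Nat.eq_of_mul_eq_mul_right hr (by simpa using h)

lemma coset_subset_Z (hr : 0 < r) (hqr : q ≡ 1 [MOD r]) (hx : x ∈ Z n r) :
    coset q (n * r) x ⊆ Z n r := by
  intro y hy
  obtain ⟨hy, j, hj⟩ := mem_coset.1 hy
  refine (mem_Z_iff hr).2 ⟨hy, (hj.of_mul_left n).trans ?_⟩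
  simpa using ((mem_Z_iff hr).1 hx).2.mul (hqr.pow j)

lemma mem_leaders : x ∈ leaders q n r l ↔ x ∈ Z n r ∧ (coset q (n * r) x).card = l ∧
    ∀ y ∈ coset q (n * r) x, x ≤ y := by
  simp [leaders]

lemma exists_leader (hr : 0 < r) (hqr : q ≡ 1 [MOD r]) (hm : q ^ m ≡ 1 [MOD n * r]) (hm0 : 0 < m)
    (hx : x ∈ Z n r) :
    ∃ y ∈ leaders q n r (coset q (n * r) x).card, y ≤ x ∧ coset q (n * r) y = coset q (n * r) x := by
  have hb := bounds_of_mem_Z hr hx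
  have hxx := self_mem_coset (q := q) hb
  have hne : (coset q (n * r) x).Nonempty := ⟨x, hxx⟩
  have hy := Finset.min'_mem _ hne
  have e := coset_eq_of_mem hm hm0 hb hy
  refine ⟨_, mem_leaders.2 ⟨coset_subset_Z hr hqr hx hy, by rw [e], ?_⟩,
    Finset.min'_le _ _ hxx, e⟩
  intro z hz
  rw [e] at hz
  exact Finset.min'_le _ _ hz

lemma coset_injOn_leaders (hr : 0 < r) :
    Set.InjOn (coset q (n * r))
      {x | x ∈ Z n r ∧ ∀ y ∈ coset q (n * r) x, x ≤ y} := by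
  rintro x ⟨hx, hx'⟩ y ⟨hy, hy'⟩ h
  apply le_antisymm
  · apply hx'; rw [h]; exact self_mem_coset (bounds_of_mem_Z hr hy)
  · apply hy'; rw [← h]; exact self_mem_coset (bounds_of_mem_Z hr hx)

lemma card_leaders (hr : 0 < r) (hqr : q ≡ 1 [MOD r]) (hm : q ^ m ≡ 1 [MOD n * r])
    (hm0 : 0 < m) : (leaders q n r l).card = numCosets q n r l := by
  classical
  rw [numCosets]
  have : ((Z n r).image (coset q (n * r))).filter (fun c => c.card = l)
      = (leaders q n r l).image (coset q (n * r)) := by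
    ext c
    simp only [Finset.mem_filter, Finset.mem_image]
    constructor
    · rintro ⟨⟨x, hx, rfl⟩, h⟩
      obtain ⟨y, hy, -, e⟩ := exists_leader hr hqr hm hm0 hx
      exact ⟨y, h ▸ hy, e⟩
    · rintro ⟨y, hy, rfl⟩
      exact ⟨⟨y, (mem_leaders.1 hy).1, rfl⟩, (mem_leaders.1 hy).2.1⟩
  rw [this, Finset.card_image_of_injOn]
  refine (coset_injOn_leaders hr).mono fun x hx => ?_
  exact ⟨(mem_leaders.1 hx).1, (mem_leaders.1 hx).2.2⟩

/-- In a finite set of naturals, exactly `min k |A|` elements have fewer than `k` predecessors. -/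
lemma card_filter_rank_lt (A : Finset ℕ) (k : ℕ) :
    (A.filter fun i => (A.filter fun x => x < i).card < k).card = min k A.card := by
  set ρ : ℕ → ℕ := fun i => (A.filter fun x => x < i).card with hρ
  have hlt : ∀ i ∈ A, ρ i < A.card := fun i hi =>
    Finset.card_lt_card ⟨Finset.filter_subset _ _, fun h => by simpa using h hi⟩
  have hmono : ∀ i ∈ A, ∀ j ∈ A, i < j → ρ i < ρ j := by
    intro i hi j hj hij
    refine Finset.card_lt_card ⟨fun x hx => ?_, fun h => ?_⟩
    · simp only [Finset.mem_filter] at hx ⊢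
      exact ⟨hx.1, hx.2.trans hij⟩
    · have := h (Finset.mem_filter.2 ⟨hi, hij⟩)
      simp at this
  have hinj : Set.InjOn ρ A := by
    intro i hi j hj h
    rcases lt_trichotomy i j with h1 | h1 | h1
    · exact absurd h (hmono i hi j hj h1).ne
    · exact h1
    · exact absurd h (hmono j hj i hi h1).ne'
  have himg : A.image ρ = Finset.range A.card := by
    apply Finset.eq_of_subset_of_card_le
    · intro y hy
      obtain ⟨i, hi, rfl⟩ := Finset.mem_image.1 hy
      exact Finset.mem_range.2 (hlt i hi)
    · rw [Finset.card_image_of_injOn hinj, Finset.card_range]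
  have h2 : (A.filter fun i => ρ i < k).image ρ = Finset.range (min k A.card) := by
    ext y
    simp only [Finset.mem_image, Finset.mem_filter, Finset.mem_range, lt_min_iff]
    constructor
    · rintro ⟨i, ⟨hi, hk⟩, rfl⟩
      exact ⟨hk, hlt i hi⟩
    · rintro ⟨hk, hy⟩
      obtain ⟨i, hi, rfl⟩ := Finset.mem_image.1 (himg ▸ Finset.mem_range.2 hy)
      exact ⟨i, ⟨hi, hk⟩, rfl⟩
  rw [← Finset.card_range (min k A.card), ← h2, Finset.card_image_of_injOn]
  exact hinj.mono fun x hx => (Finset.mem_filter.1 hx).1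

lemma firstLeaders_subset : firstLeaders q n r l k ⊆ leaders q n r l := Finset.filter_subset _ _

lemma card_firstLeaders (hr : 0 < r) (hqr : q ≡ 1 [MOD r]) (hm : q ^ m ≡ 1 [MOD n * r])
    (hm0 : 0 < m) (hk : k ≤ numCosets q n r l) : (firstLeaders q n r l k).card = k := by
  rw [firstLeaders, card_filter_rank_lt, card_leaders hr hqr hm hm0, min_eq_left hk]

/-- If at most `k` leaders of size `l` lie below `B`, then every element below `B` whose coset has
size `l` is in one of the first `k` cosets of size `l`. -/
lemma mem_cosetUnion_firstLeaders (hr : 0 < r) (hqr : q ≡ 1 [MOD r])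
    (hm : q ^ m ≡ 1 [MOD n * r]) (hm0 : 0 < m) {B : ℕ}
    (hB : ((leaders q n r l).filter fun y => y < B).card ≤ k) (hx : x ∈ Z n r) (hxB : x < B)
    (hl : (coset q (n * r) x).card = l) : x ∈ cosetUnion q n r (firstLeaders q n r l k) := by
  obtain ⟨y, hy, hyx, e⟩ := exists_leader hr hqr hm hm0 hx
  rw [hl] at hy
  refine Finset.mem_biUnion.2 ⟨y, ?_, by rw [e]; exact self_mem_coset (bounds_of_mem_Z hr hx)⟩
  -- The leader `y ≤ x < B` is itself among the leaders below `B`, so strictly fewer than `k`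
  -- precede it.
  refine Finset.mem_filter.2 ⟨hy, lt_of_lt_of_le (Finset.card_lt_card ⟨fun z hz => ?_, fun h => ?_⟩) hB⟩
  · simp only [Finset.mem_filter] at hz ⊢
    exact ⟨hz.1, by omega⟩
  · have := h (Finset.mem_filter.2 ⟨hy, by omega⟩)
    simp at this

lemma pairwiseDisjoint_coset (hr : 0 < r) (hm : q ^ m ≡ 1 [MOD n * r]) (hm0 : 0 < m) {L : Finset ℕ}
    (hL : ∀ x ∈ L, x ∈ Z n r ∧ ∀ y ∈ coset q (n * r) x, x ≤ y) :
    (L : Set ℕ).PairwiseDisjoint (coset q (n * r)) := by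
  intro x hx y hy hxy
  rw [Function.onFun, Finset.disjoint_left]
  intro z hzx hzy
  apply hxy
  apply coset_injOn_leaders hr (hL x hx) (hL y hy)
  rw [← coset_eq_of_mem hm hm0 (bounds_of_mem_Z hr (hL x hx).1) hzx,
    coset_eq_of_mem hm hm0 (bounds_of_mem_Z hr (hL y hy).1) hzy]

/-- The elements whose coset has size `l` are partitioned into `N_l` cosets of size `l`. -/
lemma card_filter_card_coset (hr : 0 < r) (hqr : q ≡ 1 [MOD r]) (hm : q ^ m ≡ 1 [MOD n * r])
    (hm0 : 0 < m) : ((Z n r).filter fun x => (coset q (n * r) x).card = l).card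
      = numCosets q n r l * l := by
  classical
  have : ((Z n r).filter fun x => (coset q (n * r) x).card = l)
      = (leaders q n r l).biUnion (coset q (n * r)) := by
    ext x
    simp only [Finset.mem_filter, Finset.mem_biUnion]
    constructor
    · rintro ⟨hx, hl⟩
      obtain ⟨y, hy, -, e⟩ := exists_leader hr hqr hm hm0 hx
      exact ⟨y, hl ▸ hy, e ▸ self_mem_coset (bounds_of_mem_Z hr hx)⟩
    · rintro ⟨y, hy, hxy⟩
      obtain ⟨hyZ, hyl, -⟩ := mem_leaders.1 hy
      refine ⟨coset_subset_Z hr hqr hyZ hxy, ?_⟩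
      rw [coset_eq_of_mem hm hm0 (bounds_of_mem_Z hr hyZ) hxy, hyl]
  rw [this, Finset.card_biUnion, Finset.sum_congr rfl (fun x hx => (mem_leaders.1 hx).2.1),
    Finset.sum_const, card_leaders hr hqr hm hm0, smul_eq_mul]
  exact pairwiseDisjoint_coset hr hm hm0
    fun x hx => ⟨(mem_leaders.1 hx).1, (mem_leaders.1 hx).2.2⟩

lemma card_cosetUnion_firstLeaders {a c : ℕ} (hr : 0 < r) (hqr : q ≡ 1 [MOD r])
    (hm : q ^ m ≡ 1 [MOD n * r]) (hm0 : 0 < m) {l' : ℕ} (hll : l ≠ l')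
    (ha : a ≤ numCosets q n r l) (hc : c ≤ numCosets q n r l') :
    (cosetUnion q n r (firstLeaders q n r l a ∪ firstLeaders q n r l' c)).card
      = a * l + c * l' := by
  have hsub : ∀ x ∈ firstLeaders q n r l a ∪ firstLeaders q n r l' c,
      x ∈ Z n r ∧ ∀ y ∈ coset q (n * r) x, x ≤ y := by
    intro x hx
    rcases Finset.mem_union.1 hx with hx | hx <;>
    · have := mem_leaders.1 (firstLeaders_subset hx)
      exact ⟨this.1, this.2.2⟩
  have hdisj : Disjoint (firstLeaders q n r l a) (firstLeaders q n r l' c) := by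
    rw [Finset.disjoint_left]
    intro x hx hx'
    apply hll
    rw [← (mem_leaders.1 (firstLeaders_subset hx)).2.1,
      (mem_leaders.1 (firstLeaders_subset hx')).2.1]
  rw [cosetUnion, Finset.card_biUnion (pairwiseDisjoint_coset hr hm hm0 hsub),
    Finset.sum_union hdisj,
    Finset.sum_congr rfl (fun x hx => (mem_leaders.1 (firstLeaders_subset hx)).2.1),
    Finset.sum_congr (g := fun _ => l') rfl
      (fun x hx => (mem_leaders.1 (firstLeaders_subset hx)).2.1),
    Finset.sum_const, Finset.sum_const, card_firstLeaders hr hqr hm hm0 ha,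
    card_firstLeaders hr hqr hm hm0 hc, smul_eq_mul, smul_eq_mul]

end Cosets

/-! ### Minimal polynomials, constacyclic codes and the BCH bound -/

section Codes

variable {F : Type*} [Field F]

/-- Over an extension, an element fixed by the Frobenius of a finite field lies in that field. -/
lemma exists_algebraMap_eq_of_pow_card [Finite F] {K : Type*} [Field K] [Algebra F K] {c : K}
    (hc : c ^ Nat.card F = c) : ∃ a : F, algebraMap F K a = c := by
  classical
  have := Fintype.ofFinite F
  rw [Nat.card_eq_fintype_card] at hc
  have h1 : 1 < Fintype.card F := Fintype.one_lt_card
  -- This polynomial already splits over `F`, so every root in an extension is one of the `a : F`.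
  have hs : (X ^ Fintype.card F - X : F[X]) = ∏ a : F, (X - C a) := by
    have h := Polynomial.prod_multiset_X_sub_C_of_monic_of_roots_card_eq
      (p := (X ^ Fintype.card F - X : F[X])) (monic_X_pow_sub (by simpa using h1))
      (by rw [FiniteField.roots_X_pow_card_sub_X,
        FiniteField.X_pow_card_sub_X_natDegree_eq F h1]; simp)
    rw [← h, FiniteField.roots_X_pow_card_sub_X]
    rfl
  have h0 : aeval c (X ^ Fintype.card F - X : F[X]) = 0 := by simp [hc]
  rw [hs, map_prod, Finset.prod_eq_zero_iff] at h0
  obtain ⟨a, -, ha⟩ := h0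
  exact ⟨a, (sub_eq_zero.1 (by simpa using ha)).symm⟩

variable [Finite F] {q n r m N : ℕ} {β : AlgebraicClosure F}

lemma aeval_pow_card (hq : Nat.card F = q) (f : F[X]) (x : AlgebraicClosure F) :
    aeval (x ^ q) f = (aeval x f) ^ q := by
  have := Fintype.ofFinite F
  rw [← hq, Nat.card_eq_fintype_card]
  exact Polynomial.aeval_algHom_apply
    (FiniteField.frobeniusAlgHom F (AlgebraicClosure F)) x f

lemma aeval_pow_card_pow_eq_zero (hq : Nat.card F = q) (f : F[X]) (x : AlgebraicClosure F)
    (hx : aeval x f = 0) (j : ℕ) : aeval (x ^ q ^ j) f = 0 := by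
  have hq0 : q ≠ 0 := hq ▸ Nat.card_pos.ne'
  induction j with
  | zero => simpa using hx
  | succ j ih => rw [pow_succ, pow_mul, aeval_pow_card hq, ih, zero_pow hq0]

omit [Finite F] in
lemma pow_congr (hβ : IsPrimitiveRoot β N) {i j : ℕ} (h : i ≡ j [MOD N]) :
    β ^ i = β ^ j :=
  pow_eq_pow_of_modEq h hβ.pow_eq_one

omit [Finite F] in
lemma modEq_of_pow_eq_pow (hN : 0 < N) (hβ : IsPrimitiveRoot β N) {i j : ℕ}
    (h : β ^ i = β ^ j) : i ≡ j [MOD N] := by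
  rw [← pow_congr hβ (Nat.mod_modEq i N), ← pow_congr hβ (Nat.mod_modEq j N)] at h
  exact hβ.pow_inj (Nat.mod_lt _ hN) (Nat.mod_lt _ hN) h

/-- Frobenius permutes the roots `β ^ j`, since the coset is stable under multiplication by `q`. The
coefficients of the product are therefore fixed by Frobenius and lie in `F`. -/
lemma exists_map_eq_of_coset (hq : Nat.card F = q) (hN : 0 < N)
    (hm : q ^ m ≡ 1 [MOD N]) (hm0 : 0 < m)
    (hβ : IsPrimitiveRoot β N) (x : ℕ) :
    ∃ g : F[X], g.map (algebraMap F (AlgebraicClosure F)) =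
      ∏ j ∈ coset q N x, (X - C (β ^ j)) := by
  classical
  have := Fintype.ofFinite F
  set φ := FiniteField.frobeniusAlgHom F (AlgebraicClosure F) with hφ
  have hφq : ∀ z, φ z = z ^ q := fun z => by
    rw [← hq, Nat.card_eq_fintype_card]; rfl
  set P := ∏ j ∈ coset q N x, (X - C (β ^ j)) with hP
  obtain ⟨ρ, hρ⟩ : ∃ ρ : ℕ → ℕ, ∀ z, (1 ≤ ρ z ∧ ρ z ≤ N) ∧ ρ z ≡ z [MOD N] :=
    Classical.axiomOfChoice fun z => exists_modEq hN z
  have hfix : P.map (φ : AlgebraicClosure F →+* AlgebraicClosure F) = P := by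
    rw [hP, Polynomial.map_prod]
    -- Multiplication by `q ^ (m - 1)` inverts multiplication by `q`; `ρ` brings the results back
    -- into `1, …, N`.
    refine Finset.prod_nbij' (fun j => ρ (j * q)) (fun j => ρ (j * q ^ (m - 1))) ?_ ?_ ?_ ?_ ?_
    · intro j hj
      obtain ⟨-, k, hk⟩ := mem_coset.1 hj
      refine mem_coset.2 ⟨(hρ _).1, k + 1, (hρ _).2.trans ?_⟩
      rw [pow_succ, ← mul_assoc]
      exact hk.mul_right _
    · intro j hj
      obtain ⟨-, k, hk⟩ := mem_coset.1 hj
      refine mem_coset.2 ⟨(hρ _).1, k + (m - 1), (hρ _).2.trans ?_⟩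
      rw [pow_add, ← mul_assoc]
      exact hk.mul_right _
    · intro j hj
      refine eq_of_modEq (hρ _).1 (mem_coset.1 hj).1 ((hρ _).2.trans (((hρ _).2.mul_right _).trans ?_))
      rw [mul_assoc, ← pow_succ', Nat.sub_add_cancel hm0]
      simpa using hm.mul_left j
    · intro j hj
      refine eq_of_modEq (hρ _).1 (mem_coset.1 hj).1 ((hρ _).2.trans (((hρ _).2.mul_right _).trans ?_))
      rw [mul_assoc, ← pow_succ, Nat.sub_add_cancel hm0]
      simpa using hm.mul_left j
    · intro j hj
      rw [Polynomial.map_sub, map_X, map_C, pow_congr hβ (hρ _).2, pow_mul]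
      congr 2
      exact hφq _
  have hlift : P ∈ Polynomial.lifts (algebraMap F (AlgebraicClosure F)) := by
    rw [Polynomial.lifts_iff_coeff_lifts]
    intro k
    obtain ⟨a, ha⟩ := exists_algebraMap_eq_of_pow_card (F := F) (c := P.coeff k) (by
      rw [hq, ← hφq]
      conv_rhs => rw [← hfix, coeff_map]
      rfl)
    exact ⟨a, ha⟩
  exact hlift

/-- The minimal polynomial of `β ^ x` is the product over the coset of `x`. -/
lemma map_minpoly (hq : Nat.card F = q) (hm : q ^ m ≡ 1 [MOD N])
    (hm0 : 0 < m) (hβ : IsPrimitiveRoot β N) {x : ℕ} (hx : 1 ≤ x ∧ x ≤ N) :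
    (minpoly F (β ^ x)).map (algebraMap F (AlgebraicClosure F)) =
      ∏ j ∈ coset q N x, (X - C (β ^ j)) := by
  classical
  have hint : IsIntegral F (β ^ x) := Algebra.IsIntegral.isIntegral _
  obtain ⟨g, hg⟩ := exists_map_eq_of_coset hq (by omega) hm hm0 hβ x
  have hgm : g.Monic := by
    rw [← Polynomial.monic_map_iff (f := algebraMap F (AlgebraicClosure F)), hg]
    exact monic_prod_of_monic _ _ fun j _ => monic_X_sub_C _
  have h1 : minpoly F (β ^ x) ∣ g := by
    apply minpoly.dvd
    rw [← eval_map_algebraMap, hg, eval_prod]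
    exact Finset.prod_eq_zero (self_mem_coset hx) (by simp)
  have h2 : (∏ j ∈ coset q N x, (X - C (β ^ j))) ∣
      (minpoly F (β ^ x)).map (algebraMap F (AlgebraicClosure F)) := by
    apply Finset.prod_dvd_of_coprime
    · intro i hi j hj hij
      apply Polynomial.isCoprime_X_sub_C_of_isUnit_sub
      rw [isUnit_iff_ne_zero, sub_ne_zero]
      exact fun h => hij (eq_of_modEq (mem_coset.1 hi).1 (mem_coset.1 hj).1
        (modEq_of_pow_eq_pow (by omega) hβ h))
    · intro j hj
      rw [dvd_iff_isRoot, IsRoot.def, eval_map_algebraMap]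
      obtain ⟨-, k, hk⟩ := mem_coset.1 hj
      rw [pow_congr hβ hk, pow_mul]
      exact aeval_pow_card_pow_eq_zero hq _ _ (minpoly.aeval _ _) k
  refine (eq_of_monic_of_associated ?_ ((minpoly.monic hint).map _) ?_).symm
  · exact monic_prod_of_monic _ _ fun j _ => monic_X_sub_C _
  · refine associated_of_dvd_dvd h2 ?_
    rw [← hg]
    exact Polynomial.map_dvd _ h1

omit [Finite F] in
lemma monic_genPoly (β : AlgebraicClosure F) (L : Finset ℕ) : (genPoly β L).Monic :=
  monic_prod_of_monic _ _ fun _ _ => minpoly.monic (Algebra.IsIntegral.isIntegral _)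

lemma map_genPoly (hq : Nat.card F = q) (hr : 0 < r) (hm : q ^ m ≡ 1 [MOD n * r]) (hm0 : 0 < m)
    (hβ : IsPrimitiveRoot β (n * r)) {L : Finset ℕ}
    (hL : ∀ x ∈ L, x ∈ Z n r ∧ ∀ y ∈ coset q (n * r) x, x ≤ y) :
    (genPoly β L).map (algebraMap F (AlgebraicClosure F)) =
      ∏ j ∈ cosetUnion q n r L, (X - C (β ^ j)) := by
  rw [genPoly, Polynomial.map_prod, cosetUnion,
    Finset.prod_biUnion (pairwiseDisjoint_coset hr hm hm0 hL)]
  exact Finset.prod_congr rfl fun x hx =>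
    map_minpoly hq hm hm0 hβ (bounds_of_mem_Z hr (hL x hx).1)

lemma cosetUnion_subset_Z (hr : 0 < r) (hqr : q ≡ 1 [MOD r]) {L : Finset ℕ} (hL : L ⊆ Z n r) :
    cosetUnion q n r L ⊆ Z n r := fun x hx => by
  obtain ⟨y, hy, hxy⟩ := Finset.mem_biUnion.1 hx
  exact coset_subset_Z hr hqr (hL hy) hxy

/-- The factors `X - β ^ j` are pairwise coprime, and `(β ^ (1 + k r)) ^ n = β ^ n` because `β ^ (n
r) = 1`. -/
lemma genPoly_dvd (hq : Nat.card F = q) (hr : 0 < r) (hqr : q ≡ 1 [MOD r])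
    (hm : q ^ m ≡ 1 [MOD n * r]) (hm0 : 0 < m)
    (hβ : IsPrimitiveRoot β (n * r)) {L : Finset ℕ} {a : F}
    (ha : algebraMap F (AlgebraicClosure F) a = β ^ n)
    (hL : ∀ x ∈ L, x ∈ Z n r ∧ ∀ y ∈ coset q (n * r) x, x ≤ y) :
    genPoly β L ∣ X ^ n - C a := by
  rw [← Polynomial.map_dvd_map' (algebraMap F (AlgebraicClosure F)),
    map_genPoly hq hr hm hm0 hβ hL]
  have hZ := cosetUnion_subset_Z hr hqr fun x hx => (hL x hx).1
  apply Finset.prod_dvd_of_coprime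
  · intro i hi j hj hij
    apply Polynomial.isCoprime_X_sub_C_of_isUnit_sub
    rw [isUnit_iff_ne_zero, sub_ne_zero]
    have hi' := bounds_of_mem_Z hr (hZ hi)
    exact fun h => hij (eq_of_modEq hi' (bounds_of_mem_Z hr (hZ hj))
      (modEq_of_pow_eq_pow (by omega) hβ h))
  · intro j hj
    obtain ⟨k, -, rfl⟩ := mem_Z.1 (hZ hj)
    rw [dvd_iff_isRoot, IsRoot.def]
    simp only [Polynomial.map_sub, Polynomial.map_pow, map_X, map_C, eval_sub, eval_pow, eval_X,
      eval_C, ha]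
    rw [sub_eq_zero, ← pow_mul]
    apply pow_congr hβ
    have : (1 + k * r) * n = n + n * r * k := by ring
    rw [this]
    simp [Nat.ModEq]

lemma definingSet_genPoly (hq : Nat.card F = q) (hr : 0 < r) (hqr : q ≡ 1 [MOD r])
    (hm : q ^ m ≡ 1 [MOD n * r]) (hm0 : 0 < m)
    (hβ : IsPrimitiveRoot β (n * r)) {L : Finset ℕ}
    (hL : ∀ x ∈ L, x ∈ Z n r ∧ ∀ y ∈ coset q (n * r) x, x ≤ y) :
    definingSet n r β (genPoly β L) = cosetUnion q n r L := by
  have hZ := cosetUnion_subset_Z hr hqr fun x hx => (hL x hx).1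
  ext i
  simp only [definingSet, Finset.mem_filter]
  rw [← eval_map_algebraMap, map_genPoly hq hr hm hm0 hβ hL, eval_prod, Finset.prod_eq_zero_iff]
  constructor
  · rintro ⟨hi, j, hj, h⟩
    simp only [eval_sub, eval_X, eval_C, sub_eq_zero] at h
    have hi' := bounds_of_mem_Z hr hi
    rwa [eq_of_modEq hi' (bounds_of_mem_Z hr (hZ hj)) (modEq_of_pow_eq_pow (by omega) hβ h)]
  · intro hi
    exact ⟨hZ hi, i, hi, by simp⟩

lemma natDegree_genPoly (hq : Nat.card F = q) (hr : 0 < r)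
    (hm : q ^ m ≡ 1 [MOD n * r]) (hm0 : 0 < m)
    (hβ : IsPrimitiveRoot β (n * r)) {L : Finset ℕ}
    (hL : ∀ x ∈ L, x ∈ Z n r ∧ ∀ y ∈ coset q (n * r) x, x ≤ y) :
    (genPoly β L).natDegree = (cosetUnion q n r L).card := by
  rw [← (monic_genPoly β L).natDegree_map (algebraMap F (AlgebraicClosure F)),
    map_genPoly hq hr hm hm0 hβ hL, natDegree_prod_of_monic _ _ fun j _ => monic_X_sub_C _]
  simp_rw [natDegree_X_sub_C]
  simp

omit [Finite F]

/-- The polynomial `c_0 + c_1 x + ⋯ + c_{n-1} x^{n-1}` of a word. -/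
def wordPoly (c : Fin n → F) : F[X] := ∑ i : Fin n, C (c i) * X ^ (i : ℕ)

lemma phi_eq_mk (a : F) (c : Fin n → F) :
    phi n a c = AdjoinRoot.mk (X ^ n - C a) (wordPoly c) := by
  simp only [phi, wordPoly, Fintype.linearCombination_apply, map_sum, map_mul, map_pow,
    AdjoinRoot.mk_X, AdjoinRoot.mk_C, Algebra.smul_def, AdjoinRoot.algebraMap_eq]

/-- Since `g` divides `X ^ n - a`, membership in the ideal modulo `X ^ n - a` lifts to divisibility
of polynomials. -/
lemma mem_codeOf {a : F} {g : F[X]} (hg : g ∣ X ^ n - C a) {c : Fin n → F} :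
    c ∈ codeOf n a g ↔ g ∣ wordPoly c := by
  rw [codeOf, Submodule.mem_comap, Submodule.restrictScalars_mem, phi_eq_mk,
    Ideal.mem_span_singleton]
  constructor
  · rintro ⟨y, hy⟩
    obtain ⟨y, rfl⟩ := AdjoinRoot.mk_surjective y
    rw [← map_mul, AdjoinRoot.mk_eq_mk] at hy
    have := (hg.trans hy).add (dvd_mul_right g y)
    simpa using this
  · rintro ⟨y, hy⟩
    rw [hy, map_mul]
    exact dvd_mul_right _ _

lemma isConstacyclic_codeOf (a : F) (g : F[X]) : IsConstacyclic a (codeOf n a g) := by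
  intro c hc
  rw [codeOf, Submodule.mem_comap, Submodule.restrictScalars_mem] at hc ⊢
  -- The shift is multiplication by `x`; the last coefficient wraps around through `x ^ n = a`.
  have : phi n a (shift a c) = AdjoinRoot.root (X ^ n - C a) * phi n a c := by
    cases n with
    | zero => simp [phi, Fintype.linearCombination_apply]
    | succ n =>
      have hroot : (AdjoinRoot.root (X ^ (n + 1) - C a)) ^ (n + 1)
          = algebraMap F (AdjoinRoot (X ^ (n + 1) - C a)) a := by
        have := AdjoinRoot.eval₂_root (X ^ (n + 1) - C a)
        simpa [sub_eq_zero] using this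
      simp only [phi, Fintype.linearCombination_apply, Algebra.smul_def]
      rw [Fin.sum_univ_succ, Fin.sum_univ_castSucc, mul_add,
        add_comm (algebraMap _ _ (shift a c 0) * _), Finset.mul_sum]
      congr 1
      · refine Finset.sum_congr rfl fun i _ => ?_
        simp only [shift, Fin.val_succ, Nat.add_one_ne_zero, if_false, Nat.add_sub_cancel,
          Fin.val_castSucc]
        have : (⟨(i : ℕ), by omega⟩ : Fin (n + 1)) = i.castSucc := rfl
        rw [this]
        ring
      · simp only [shift, Fin.val_zero, if_true, pow_zero, mul_one, Fin.val_last, map_mul]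
        have : (⟨n + 1 - 1, by omega⟩ : Fin (n + 1)) = Fin.last n := rfl
        rw [this, mul_left_comm, ← pow_succ', hroot, mul_comm]
  rw [this]
  exact Ideal.mul_mem_left _ _ hc

/-- The code is the kernel of `F ^ n → F[x]/(g)`. This map is onto because remainders modulo `g`
have degree below `n`, and the target has dimension `deg g`. -/
lemma finrank_codeOf {a : F} {g : F[X]} (hmon : g.Monic) (hg : g ∣ X ^ n - C a) (hn : 0 < n) :
    Module.finrank F (codeOf n a g) + g.natDegree = n := by
  have hdeg : g.natDegree ≤ n := by
    have := natDegree_le_of_dvd hg (X_pow_sub_C_ne_zero hn a)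
    rwa [natDegree_X_pow_sub_C] at this
  let ψ : (Fin n → F) →ₗ[F] AdjoinRoot g :=
    Fintype.linearCombination F fun i : Fin n => (AdjoinRoot.root g) ^ (i : ℕ)
  have hψ : ∀ c, ψ c = AdjoinRoot.mk g (wordPoly c) := fun c => by
    simp only [ψ, wordPoly, Fintype.linearCombination_apply, map_sum, map_mul, map_pow,
      AdjoinRoot.mk_X, AdjoinRoot.mk_C, Algebra.smul_def, AdjoinRoot.algebraMap_eq]
  have hker : LinearMap.ker ψ = codeOf n a g := by
    ext c
    rw [LinearMap.mem_ker, hψ, AdjoinRoot.mk_eq_zero, mem_codeOf hg]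
  have hsurj : LinearMap.range ψ = ⊤ := by
    rw [LinearMap.range_eq_top]
    intro z
    obtain ⟨f, rfl⟩ := AdjoinRoot.mk_surjective z
    refine ⟨fun i => (f %ₘ g).coeff i, ?_⟩
    have hw : wordPoly (fun i : Fin n => (f %ₘ g).coeff i) = f %ₘ g := by
      rw [wordPoly, Fin.sum_univ_eq_sum_range (fun i => C ((f %ₘ g).coeff i) * X ^ i) n]
      by_cases h1 : g = 1
      · simp [h1]
      · exact ((f %ₘ g).as_sum_range_C_mul_X_pow' ((natDegree_modByMonic_lt f hmon h1).trans_le hdeg)).symm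
    rw [hψ, hw, AdjoinRoot.mk_eq_mk]
    rw [← neg_sub, dvd_neg]
    exact ⟨f /ₘ g, by rw [sub_eq_iff_eq_add, add_comm, modByMonic_add_div f g]⟩
  have h := LinearMap.finrank_range_add_finrank_ker ψ
  rw [hker, hsurj, finrank_top, (AdjoinRoot.powerBasis hmon.ne_zero).finrank,
    AdjoinRoot.powerBasis_dim, Module.finrank_fin_fun] at h
  omega

/-- The BCH bound: a nonzero word whose polynomial vanishes at `β, β^{1+r}, …, β^{1+(K-1)r}` has
weight larger than `K`. -/
lemma lt_hammingNorm [DecidableEq F] {K : ℕ} (hr : 0 < r) (hβ : IsPrimitiveRoot β (n * r))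
    {c : Fin n → F} (hc : c ≠ 0) (h0 : ∀ k < K, aeval (β ^ (1 + k * r)) (wordPoly c) = 0) :
    K < hammingNorm c := by
  by_contra! hle
  obtain ⟨i₀, hi₀⟩ := Function.ne_iff.1 hc
  set s : Finset (Fin n) := Finset.univ.filter fun i => c i ≠ 0 with hs
  have hi₀s : i₀ ∈ s := by simpa [hs] using hi₀
  have hcard : s.card ≤ K := hle
  have hn : 0 < n := i₀.pos
  have hβ0 : β ≠ 0 := hβ.ne_zero (Nat.mul_pos hn hr).ne'
  -- Linear combinations of the `K` vanishing conditions allow any test polynomial of degree below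
  -- `K`. Choosing one that vanishes on the support except at `i₀` isolates a single nonzero term,
  -- which replaces a Vandermonde determinant.
  have key : ∀ h : (AlgebraicClosure F)[X], h.natDegree < K →
      ∑ i : Fin n, algebraMap F (AlgebraicClosure F) (c i) * β ^ (i : ℕ)
        * h.eval (β ^ (r * (i : ℕ))) = 0 := by
    intro h hh
    simp_rw [eval_eq_sum_range' hh, Finset.mul_sum]
    rw [Finset.sum_comm]
    refine Finset.sum_eq_zero fun k hk => ?_
    have := h0 k (Finset.mem_range.1 hk)
    rw [wordPoly, map_sum] at this
    rw [← mul_zero (h.coeff k), ← this, Finset.mul_sum]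
    refine Finset.sum_congr rfl fun i _ => ?_
    simp only [map_mul, aeval_C, map_pow, aeval_X]
    ring
  have hdeg : (∏ i ∈ s.erase i₀, (X - C (β ^ (r * (i : ℕ))))).natDegree < K := by
    rw [natDegree_prod_of_monic _ _ fun j _ => monic_X_sub_C _]
    simp only [natDegree_X_sub_C, Finset.sum_const, smul_eq_mul, mul_one]
    exact (Finset.card_erase_lt_of_mem hi₀s).trans_le hcard
  have h1 := key _ hdeg
  rw [Finset.sum_eq_single i₀] at h1
  · rw [mul_eq_zero, mul_eq_zero, eval_prod, Finset.prod_eq_zero_iff] at h1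
    rcases h1 with (h1 | h1) | ⟨i, hi, h1⟩
    · exact hi₀ (by simpa using h1)
    · exact pow_ne_zero _ hβ0 h1
    · simp only [eval_sub, eval_X, eval_C, sub_eq_zero] at h1
      have h2 : r * (i₀ : ℕ) ≡ r * i [MOD n * r] := modEq_of_pow_eq_pow (Nat.mul_pos hn hr) hβ h1
      rw [mul_comm n r] at h2
      have h3 := Nat.ModEq.eq_of_lt_of_lt (Nat.ModEq.mul_left_cancel' hr.ne' h2) i₀.2 i.2
      exact (Finset.ne_of_mem_erase hi) (Fin.ext h3.symm)
  · intro i _ hi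
    by_cases hci : c i = 0
    · simp [hci]
    · rw [eval_prod, Finset.prod_eq_zero (i := i), mul_zero]
      · simp [hs, hi, hci]
      · simp
  · simp

lemma lt_minDist {K : ℕ} (hr : 0 < r) (hβ : IsPrimitiveRoot β (n * r))
    {C : Submodule F (Fin n → F)} (hC : 0 < Module.finrank F C)
    (h0 : ∀ c ∈ C, ∀ k < K, aeval (β ^ (1 + k * r)) (wordPoly c) = 0) :
    K < minDist C := by
  classical
  rw [minDist]
  have hne : {d | ∃ x ∈ C, ∃ y ∈ C, x ≠ y ∧ hammingDist x y = d}.Nonempty := by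
    have : C ≠ ⊥ := by rintro rfl; simp at hC
    obtain ⟨x, hx, hx0⟩ := Submodule.exists_mem_ne_zero_of_ne_bot this
    exact ⟨_, x, hx, 0, C.zero_mem, hx0, rfl⟩
  have hmem := Nat.sInf_mem hne
  obtain ⟨x, hx, y, hy, hxy, h⟩ := hmem
  rw [← h, hammingDist_comm, hammingDist_eq_hammingNorm, neg_add_eq_sub]
  exact lt_hammingNorm hr hβ (sub_ne_zero.2 hxy) (h0 _ (C.sub_mem hx hy))

/-- The code of `genPoly β L` has dimension `n - |T|` and minimum distance at least `K + 1`, if the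
union `T` of the cosets contains the first `K` elements of `Z_{n,r}`. -/
lemma generates [Finite F] (hq : Nat.card F = q) (hr : 0 < r) (hqr : q ≡ 1 [MOD r])
    (hm : q ^ m ≡ 1 [MOD n * r]) (hm0 : 0 < m)
    (hβ : IsPrimitiveRoot β (n * r)) {L : Finset ℕ} {a : F}
    (ha : algebraMap F (AlgebraicClosure F) a = β ^ n)
    (hL : ∀ x ∈ L, x ∈ Z n r ∧ ∀ y ∈ coset q (n * r) x, x ≤ y) {K : ℕ} {k d : ℤ}
    (hK : ∀ i < K, 1 + i * r ∈ cosetUnion q n r L)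
    (hk : k = n - ((cosetUnion q n r L).card : ℤ)) (hk0 : 0 < k) (hd : d ≤ K + 1) :
    Generates q n r a β L k d := by
  have hn : 0 < n := by omega
  have hdvd := genPoly_dvd hq hr hqr hm hm0 hβ ha hL
  have hfr := finrank_codeOf (monic_genPoly β L) hdvd hn
  rw [natDegree_genPoly hq hr hm hm0 hβ hL] at hfr
  refine ⟨hdvd, definingSet_genPoly hq hr hqr hm hm0 hβ hL, isConstacyclic_codeOf _ _,
    by omega, ?_⟩
  have : K < minDist (codeOf n a (genPoly β L)) := by
    refine lt_minDist hr hβ (by omega) fun c hc i hi => ?_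
    obtain ⟨f, hf⟩ := (mem_codeOf hdvd).1 hc
    have hz : 1 + i * r ∈ definingSet n r β (genPoly β L) := by
      rw [definingSet_genPoly hq hr hqr hm hm0 hβ hL]
      exact hK i hi
    simp only [definingSet, Finset.mem_filter] at hz
    rw [hf, map_mul, hz.2, zero_mul]
  omega

end Codes

/-! ### Cosets for lengths `Φ_{p^b}(q)` -/

/-- The length `n = Φ_{p ^ (b + 1)}(q)` with the divisibility conditions on `r` and `p`. -/
structure IsLength (q p r b n : ℕ) : Prop where
  prime : p.Prime
  two_le : 2 ≤ q
  dvd_sub_one : r ∣ q - 1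
  dvd_div : p ∣ (q - 1) / r
  eq_sum : n = ∑ j ∈ Finset.range p, (q ^ p ^ b) ^ j

namespace IsLength

variable {q p r b n : ℕ} (H : IsLength q p r b n)
include H

lemma r_pos : 0 < r := by
  have := H.two_le
  exact Nat.pos_of_dvd_of_pos H.dvd_sub_one (by omega)

lemma exists_eq_mul_add_one : ∃ e, q = r * e + 1 ∧ p ∣ e ∧ 0 < e := by
  have h2 := H.two_le
  obtain ⟨e, he⟩ := H.dvd_sub_one
  have hp := H.dvd_div
  rw [he, Nat.mul_div_cancel_left _ H.r_pos] at hp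
  refine ⟨e, by omega, hp, Nat.pos_of_ne_zero ?_⟩
  rintro rfl
  omega

lemma p_lt : p < q := by
  obtain ⟨e, he, hpe, he0⟩ := H.exists_eq_mul_add_one
  have h1 := Nat.le_of_dvd he0 hpe
  have h2 := Nat.le_mul_of_pos_left e H.r_pos
  omega

lemma three_le : 3 ≤ q := by
  have := H.prime.two_le
  have := H.p_lt
  omega

lemma modEq_one : q ≡ 1 [MOD r] := by
  obtain ⟨e, he, -⟩ := H.exists_eq_mul_add_one
  rw [he]
  simp [Nat.ModEq]

lemma exponent_pos : 0 < p ^ (b + 1) := pow_pos H.prime.pos _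

/-- The cofactor `s` and the quotient `w = n / p`. -/
lemma exists_cofactor : ∃ s' t, q ^ p ^ b = r * (p * s') + 1 ∧ 0 < s' ∧
    n = p * (1 + s' * r * t) ∧ n * r * (p * s') + 1 = q ^ p ^ (b + 1) := by
  obtain ⟨e, he, ⟨e', rfl⟩, he0⟩ := H.exists_eq_mul_add_one
  have h1 : q - 1 ∣ q ^ p ^ b - 1 := by simpa using Nat.sub_dvd_pow_sub_pow q 1 (p ^ b)
  obtain ⟨c, hc⟩ := h1
  have hq := H.two_le
  have hQ : q ≤ q ^ p ^ b := Nat.le_self_pow (pow_pos H.prime.pos _).ne' q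
  have hq1 : q - 1 = r * (p * e') := by rw [he, Nat.add_sub_cancel]
  rw [hq1] at hc
  have hQ1 : q ^ p ^ b = r * (p * (e' * c)) + 1 := by
    have : r * (p * (e' * c)) = r * (p * e') * c := by ring
    rw [this, ← hc]
    exact (Nat.sub_add_cancel (by omega)).symm
  have hpos : 0 < e' * c := by
    rcases Nat.eq_zero_or_pos (e' * c) with h | h
    · rw [h, mul_zero, mul_zero] at hQ1; omega
    · exact h
  have hsum : n * (r * (p * (e' * c))) + 1 = q ^ p ^ (b + 1) := by
    rw [H.eq_sum, hQ1, geom_sum_mul_add, ← hQ1, ← pow_mul, ← pow_succ]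
  -- Each power of `Q` is `1` modulo `Q - 1`, so the `p` terms of the sum add up to `p`.
  have hmod : n ≡ p [MOD r * (p * (e' * c))] := by
    rw [H.eq_sum, hQ1]
    have : ∀ j ∈ Finset.range p, (r * (p * (e' * c)) + 1) ^ j ≡ 1 [MOD r * (p * (e' * c))] := by
      intro j _
      have : r * (p * (e' * c)) + 1 ≡ 1 [MOD r * (p * (e' * c))] := by simp [Nat.ModEq]
      simpa using this.pow j
    have := Nat.ModEq.sum this
    simpa using this
  have hle : p ≤ n := by
    rw [H.eq_sum]
    calc p = ∑ j ∈ Finset.range p, 1 := by simp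
      _ ≤ _ := Finset.sum_le_sum fun j _ => Nat.one_le_pow _ _ (by omega)
  obtain ⟨t, ht⟩ := (Nat.modEq_iff_dvd' hle).1 hmod.symm
  refine ⟨e' * c, t, hQ1, hpos, ?_, ?_⟩
  · have : p * (1 + e' * c * r * t) = p + r * (p * (e' * c)) * t := by ring
    omega
  · rw [← hsum]
    ring

lemma lt_n : p < n := by
  rw [H.eq_sum]
  calc p = ∑ j ∈ Finset.range p, 1 := by simp
    _ < _ := by
      apply Finset.sum_lt_sum
      · exact fun j _ => Nat.one_le_pow _ _ (pow_pos (by have := H.two_le; omega) _)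
      · refine ⟨1, Finset.mem_range.2 H.prime.one_lt, ?_⟩
        rw [pow_one]
        exact Nat.one_lt_pow (pow_pos H.prime.pos _).ne' H.two_le

lemma mul_pos : 0 < n * r := Nat.mul_pos (by have := H.lt_n; omega) H.r_pos

lemma mul_cofactor : n * r * cofactor q n r (p ^ (b + 1)) = q ^ p ^ (b + 1) - 1 := by
  obtain ⟨s', t, -, -, -, h⟩ := H.exists_cofactor
  rw [cofactor]
  apply Nat.mul_div_cancel'
  exact ⟨p * s', by omega⟩

lemma cofactor_pos : 0 < cofactor q n r (p ^ (b + 1)) := by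
  have h := H.mul_cofactor
  have : 2 ≤ q ^ p ^ (b + 1) := H.two_le.trans (Nat.le_self_pow H.exponent_pos.ne' q)
  rcases Nat.eq_zero_or_pos (cofactor q n r (p ^ (b + 1))) with h0 | h0
  · rw [h0] at h; omega
  · exact h0

lemma pow_modEq_one : q ^ p ^ (b + 1) ≡ 1 [MOD n * r] := by
  obtain ⟨s', t, -, -, -, h⟩ := H.exists_cofactor
  rw [← h]
  simp [Nat.ModEq]

/-- `w = n / p` is coprime to `r`, and `x` is fixed by `q` iff `w ∣ x`. -/
lemma exists_quotient : ∃ w, n = p * w ∧ w.Coprime r ∧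
    (∀ x, x * q ≡ x [MOD n * r] ↔ w ∣ x) ∧ ∀ x, x * q ^ p ^ b ≡ x [MOD n * r] ↔ w ∣ x := by
  obtain ⟨s', t, hQ, hs, hn, h⟩ := H.exists_cofactor
  obtain ⟨e, he, ⟨e', rfl⟩, he0⟩ := H.exists_eq_mul_add_one
  have hr := H.r_pos
  have hp := H.prime.pos
  have hcop : ∀ c d, (1 + c * d).Coprime c := fun c d => by simp
  -- For a multiplier `r p c + 1`, being fixed means that `n r = p r w` divides `p r (x c)`. The
  -- choice `c = s'` gives `Q`, and `c = e'` gives `q`.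
  have h2 : ∀ c x, x * (r * (p * c) + 1) ≡ x [MOD n * r] ↔ (1 + s' * r * t) ∣ x * c := by
    intro c x
    have e1 : x * (r * (p * c) + 1) = x + p * r * (x * c) := by ring
    have e2 : n * r = p * r * (1 + s' * r * t) := by rw [hn]; ring
    rw [e1, e2, Nat.ModEq.comm, Nat.modEq_iff_dvd' (Nat.le_add_right _ _), Nat.add_sub_cancel_left]
    exact Nat.mul_dvd_mul_iff_left (Nat.mul_pos hp hr)
  have hQx : ∀ x, x * q ^ p ^ b ≡ x [MOD n * r] ↔ (1 + s' * r * t) ∣ x := by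
    intro x
    rw [hQ, h2]
    refine ⟨fun hx => ?_, fun hx => hx.mul_right _⟩
    have : (1 + s' * r * t).Coprime s' := by rw [mul_assoc]; exact hcop _ _
    exact this.dvd_of_dvd_mul_right hx
  refine ⟨1 + s' * r * t, hn, ?_, fun x => ⟨fun hx => ?_, fun hx => ?_⟩, hQx⟩
  · rw [mul_comm s' r, mul_assoc]; exact hcop _ _
  · rw [← hQx]
    have key : ∀ j, x * q ^ j ≡ x [MOD n * r] := by
      intro j
      induction j with
      | zero => simp [Nat.ModEq]
      | succ j ih =>
        rw [pow_succ, ← mul_assoc]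
        exact (ih.mul_right q).trans hx
    exact key _
  · rw [he, h2]
    exact hx.mul_right _

lemma card_coset_eq_one_or (x : ℕ) : (coset q (n * r) x).card = 1 ∨
    (coset q (n * r) x).card = p ^ (b + 1) := by
  obtain ⟨w, -, -, h1, h2⟩ := H.exists_quotient
  exact Constacyclic.card_coset_eq_one_or H.prime H.mul_pos H.pow_modEq_one
    fun hx => (h1 x).2 ((h2 x).1 hx)

lemma one_lt_exponent : 1 < p ^ (b + 1) := Nat.one_lt_pow (by omega) H.prime.one_lt

/-- Exactly `h` of the first `w h` elements of `Z_{n,r}` have a coset of size `1`. -/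
lemma card_fixed : ∃ w, n = p * w ∧ ∀ h,
    ((Finset.range (w * h)).filter fun k => (coset q (n * r) (1 + k * r)).card = 1).card = h := by
  obtain ⟨w, hw, hcop, h1, -⟩ := H.exists_quotient
  have hw0 : 0 < w := Nat.pos_of_ne_zero fun h => by have := H.lt_n; simp [h] at hw; omega
  refine ⟨w, hw, fun h => ?_⟩
  obtain ⟨k₀, hk₀⟩ : ∃ k₀, w ∣ 1 + k₀ * r := by
    obtain ⟨c, hc1, hc2⟩ := Nat.chineseRemainder hcop.symm 1 0
    have h3 : c + w * r ≡ 1 [MOD r] := by simpa [Nat.ModEq] using hc1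
    -- The Chinese remainder may be `0`; adding `w * r` makes it positive without changing either
    -- congruence.
    have hpos : 1 ≤ c + w * r := le_add_left (Nat.mul_pos hw0 H.r_pos)
    obtain ⟨k₀, hk₀⟩ := (Nat.modEq_iff_dvd' hpos).1 h3.symm
    refine ⟨k₀, ?_⟩
    have : 1 + k₀ * r = c + w * r := by rw [mul_comm k₀]; omega
    rw [this]
    exact dvd_add ((Nat.modEq_zero_iff_dvd).1 hc2) (dvd_mul_right _ _)
  -- As `r` is invertible modulo `w`, the condition `w ∣ 1 + k r` selects one residue class of `k`,
  -- hence one index in each block of length `w`.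
  have : ∀ k, (coset q (n * r) (1 + k * r)).card = 1 ↔ k ≡ k₀ [MOD w] := by
    intro k
    rw [card_coset_eq_one_iff H.mul_pos H.pow_modEq_one H.exponent_pos, h1]
    rw [← Nat.modEq_zero_iff_dvd] at hk₀ ⊢
    constructor
    · intro hk
      have := Nat.ModEq.add_left_cancel' 1 (hk.trans hk₀.symm)
      exact Nat.ModEq.cancel_right_of_coprime hcop this
    · intro hk
      exact ((hk.mul_right r).add_left 1).trans hk₀
  simp_rw [this]
  rw [← Nat.count_eq_card_filter_range, Nat.count_modEq_card _ hw0]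
  simp [hw0]

lemma numCosets_one : numCosets q n r 1 = p := by
  have h := card_filter_card_coset (l := 1) H.r_pos H.modEq_one H.pow_modEq_one H.exponent_pos
  rw [mul_one] at h
  obtain ⟨w, hw, hc⟩ := H.card_fixed
  rw [← h, ← hc p, mul_comm w p, ← hw, Z, Finset.filter_image, Finset.card_image_of_injective]
  intro a b h
  exact Nat.eq_of_mul_eq_mul_right H.r_pos (by simpa using h)

lemma numCosets_mul : numCosets q n r (p ^ (b + 1)) * p ^ (b + 1) + p = n := by
  rw [← card_filter_card_coset H.r_pos H.modEq_one H.pow_modEq_one H.exponent_pos]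
  have h := card_filter_card_coset (l := 1) H.r_pos H.modEq_one H.pow_modEq_one H.exponent_pos
  rw [mul_one, H.numCosets_one] at h
  have hsum := Finset.card_filter_add_card_filter_not (s := Z n r)
    (fun x => (coset q (n * r) x).card = 1)
  rw [h, card_Z H.r_pos] at hsum
  have hcompl : ((Z n r).filter fun x => (coset q (n * r) x).card = p ^ (b + 1))
      = (Z n r).filter fun x => ¬ (coset q (n * r) x).card = 1 := by
    refine Finset.filter_congr fun x _ => ?_
    have := H.one_lt_exponent
    rcases H.card_coset_eq_one_or x with h | h <;> rw [h]
    · exact ⟨fun h => absurd h this.ne, fun h => absurd rfl h⟩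
    · exact ⟨fun _ => this.ne', fun _ => rfl⟩
  rw [hcompl]
  omega

lemma numCosets_pos : 0 < numCosets q n r (p ^ (b + 1)) := by
  have h1 := H.numCosets_mul
  have h2 := H.lt_n
  rcases Nat.eq_zero_or_pos (numCosets q n r (p ^ (b + 1))) with h | h
  · rw [h] at h1; omega
  · exact h

lemma setOf_card_coset :
    {l : ℕ | ∃ i ∈ Z n r, (coset q (n * r) i).card = l} = {1, p ^ (b + 1)} := by
  have key : ∀ l, 0 < numCosets q n r l → ∃ i ∈ Z n r, (coset q (n * r) i).card = l := by
    intro l hl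
    rw [← card_leaders H.r_pos H.modEq_one H.pow_modEq_one H.exponent_pos, Finset.card_pos] at hl
    obtain ⟨x, hx⟩ := hl
    exact ⟨x, (mem_leaders.1 hx).1, (mem_leaders.1 hx).2.1⟩
  ext l
  constructor
  · rintro ⟨i, -, rfl⟩
    exact H.card_coset_eq_one_or i
  · rintro (rfl | rfl)
    · exact key _ (by rw [H.numCosets_one]; exact H.prime.pos)
    · exact key _ H.numCosets_pos

/-! #### Elements which are not coset leaders -/

/-- If `x = q y`, then `y` is a smaller member of the same coset. -/
lemma not_dvd_of_mem_leaders {l x : ℕ} (hx : x ∈ leaders q n r l) : ¬ q ∣ x := by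
  rintro ⟨y, rfl⟩
  obtain ⟨hZ, -, hmin⟩ := mem_leaders.1 hx
  obtain ⟨h1, h2⟩ := bounds_of_mem_Z H.r_pos hZ
  have hq := H.two_le
  have hy : 0 < y := Nat.pos_of_ne_zero fun h => by simp [h] at h1
  have hlt : y < q * y := by nlinarith
  refine absurd (hmin y ?_) (by omega)
  refine mem_coset_symm H.pow_modEq_one H.exponent_pos ⟨hy, by omega⟩ ?_
  exact mem_coset.2 ⟨⟨h1, h2⟩, 1, by simp [mul_comm, Nat.ModEq.refl]⟩

/-- Multiplying `q ^ i + u` by `q ^ (m - i)`, with `m = p ^ (b + 1)`, gives `1 + u q ^ (m - i)`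
modulo `n r`. The hypothesis says exactly that this is smaller than `q ^ i + u`. -/
lemma notMem_leaders_of_lt {l i u : ℕ} (hi : i ≤ p ^ (b + 1))
    (hu : u * (q ^ (p ^ (b + 1) - i) - 1) + 1 < q ^ i) : q ^ i + u ∉ leaders q n r l := by
  intro hx
  obtain ⟨hZ, -, hmin⟩ := mem_leaders.1 hx
  obtain ⟨h1, h2⟩ := bounds_of_mem_Z H.r_pos hZ
  have hq1 : 1 ≤ q ^ (p ^ (b + 1) - i) := Nat.one_le_pow _ _ (by have := H.two_le; omega)
  have hlt : u * q ^ (p ^ (b + 1) - i) + 1 < q ^ i + u := by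
    obtain ⟨c, hc⟩ := Nat.exists_eq_add_of_le hq1
    rw [hc, Nat.add_sub_cancel_left] at hu
    rw [hc]
    nlinarith
  refine absurd (hmin (u * q ^ (p ^ (b + 1) - i) + 1) ?_) (by omega)
  refine mem_coset.2 ⟨⟨by omega, by omega⟩, p ^ (b + 1) - i, ?_⟩
  rw [add_mul, ← pow_add, Nat.add_sub_cancel' hi, add_comm]
  exact (H.pow_modEq_one.add_right _).symm

/-- At most `K - ⌊K / q⌋` of the first `K` elements of `Z_{n,r}` are prime to `q`. -/
lemma card_le_of_not_dvd {K : ℕ} {A : Finset ℕ}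
    (hA : ∀ x ∈ A, ¬ q ∣ x ∧ ∃ k < K, x = 1 + k * r) : A.card + K / q ≤ K := by
  obtain ⟨e, he, -⟩ := H.exists_eq_mul_add_one
  have hq : 0 < q := by omega
  -- Since `1 + e r = q`, indices `k ≡ e` modulo `q` give multiples of `q`; there are at least `⌊K /
  -- q⌋` of them below `K`.
  have hsub : A ⊆ ((Finset.range K).filter fun k => ¬ k ≡ e [MOD q]).image fun k => 1 + k * r := by
    intro x hx
    obtain ⟨hd, k, hk, rfl⟩ := hA x hx
    refine Finset.mem_image.2 ⟨k, Finset.mem_filter.2 ⟨Finset.mem_range.2 hk, fun h => hd ?_⟩, rfl⟩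
    rw [← Nat.modEq_zero_iff_dvd]
    refine ((h.mul_right r).add_left 1).trans ?_
    rw [Nat.modEq_zero_iff_dvd, he]
    exact ⟨1, by ring⟩
  have h1 := (Finset.card_le_card hsub).trans Finset.card_image_le
  have h2 := Finset.card_filter_add_card_filter_not (s := Finset.range K) (fun k => k ≡ e [MOD q])
  have h3 : K / q ≤ ((Finset.range K).filter fun k => k ≡ e [MOD q]).card := by
    rw [← Nat.count_eq_card_filter_range, Nat.count_modEq_card _ hq]
    exact Nat.le_add_right _ _
  rw [Finset.card_range] at h2
  omega

/-- The number of leaders among the first `K` elements of `Z_{n,r}`, given non-leaders `A`. -/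
lemma card_leaders_add_card_le {K l : ℕ} {A : Finset ℕ}
    (hA : ∀ x ∈ A, ¬ q ∣ x ∧ ∃ k < K, x = 1 + k * r) (hA' : ∀ x ∈ A, x ∉ leaders q n r l) :
    ((leaders q n r l).filter fun y => y < 1 + K * r).card + A.card + K / q ≤ K := by
  rw [← Finset.card_union_of_disjoint]
  · apply H.card_le_of_not_dvd
    intro x hx
    rcases Finset.mem_union.1 hx with hx | hx
    · rw [Finset.mem_filter] at hx
      refine ⟨H.not_dvd_of_mem_leaders hx.1, ?_⟩
      obtain ⟨k, -, rfl⟩ := mem_Z.1 (mem_leaders.1 hx.1).1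
      exact ⟨k, lt_of_mul_lt_mul_right (a := r) (by omega) (by omega), rfl⟩
    · exact hA x hx
  · rw [Finset.disjoint_left]
    exact fun x hx hxA => hA' x hxA (Finset.mem_filter.1 hx).1

/-- The code defined by the first `h₁` cosets of size `1` and the first `h` cosets of size
`p ^ (b + 1)`. -/
lemma generates_firstLeaders {F : Type*} [Field F] [Finite F] (hq : Nat.card F = q)
    {β : AlgebraicClosure F} (hβ : IsPrimitiveRoot β (n * r)) {a : F}
    (ha : algebraMap F (AlgebraicClosure F) a = β ^ n) {K h₁ h : ℕ} {k d : ℤ}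
    (hh₁ : h₁ < p) (hh : h ≤ numCosets q n r (p ^ (b + 1))) (hK₁ : p * K ≤ n * h₁)
    (hK : ((leaders q n r (p ^ (b + 1))).filter fun y => y < 1 + K * r).card ≤ h)
    (hk : k = n - h₁ - (p : ℤ) ^ (b + 1) * h) (hd : d ≤ K + 1) :
    Generates q n r a β (firstLeaders q n r 1 h₁ ∪ firstLeaders q n r (p ^ (b + 1)) h) k d := by
  have hr := H.r_pos
  have hqr := H.modEq_one
  have hm := H.pow_modEq_one
  have hm0 := H.exponent_pos
  have hKn : K ≤ n := by
    have : n * h₁ ≤ n * p := Nat.mul_le_mul_left _ hh₁.le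
    exact Nat.le_of_mul_le_mul_left (by rw [mul_comm p n]; omega) H.prime.pos
  have hcard := card_cosetUnion_firstLeaders hr hqr hm hm0 (l := 1) (l' := p ^ (b + 1))
    (a := h₁) (c := h) H.one_lt_exponent.ne (by rw [H.numCosets_one]; exact hh₁.le) hh
  refine generates hq hr hqr hm hm0 hβ ha ?_ (K := K) ?_ ?_ ?_ hd
  · intro x hx
    rcases Finset.mem_union.1 hx with hx | hx <;>
    · have := mem_leaders.1 (firstLeaders_subset hx)
      exact ⟨this.1, this.2.2⟩
  · intro i hi
    rw [cosetUnion, Finset.union_biUnion, Finset.mem_union]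
    have hZ : 1 + i * r ∈ Z n r := mem_Z.2 ⟨i, by omega, rfl⟩
    have hlt : 1 + i * r < 1 + K * r := by
      have := Nat.mul_lt_mul_of_pos_right hi hr
      omega
    rcases H.card_coset_eq_one_or (1 + i * r) with hc | hc
    · left
      refine mem_cosetUnion_firstLeaders hr hqr hm hm0 (B := 1 + K * r) ?_ hZ hlt hc
      obtain ⟨w, hw, hcw⟩ := H.card_fixed
      rw [← hcw h₁]
      -- The first `w h₁` elements contain exactly `h₁` singletons, so at most `h₁` leaders of size
      -- `1` lie below the bound.
      have hKw : K ≤ w * h₁ := by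
        rw [hw, mul_assoc] at hK₁
        exact Nat.le_of_mul_le_mul_left hK₁ H.prime.pos
      refine (Finset.card_le_card (t := Finset.image (fun k => 1 + k * r) _) fun y hy => ?_).trans
        Finset.card_image_le
      rw [Finset.mem_filter] at hy
      obtain ⟨hy, hyK⟩ := hy
      obtain ⟨hyZ, hy1, -⟩ := mem_leaders.1 hy
      obtain ⟨k, -, rfl⟩ := mem_Z.1 hyZ
      have : k < K := lt_of_mul_lt_mul_right (a := r) (by omega) (by omega)
      exact Finset.mem_image.2
        ⟨k, Finset.mem_filter.2 ⟨Finset.mem_range.2 (by omega), hy1⟩, rfl⟩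
    · right
      exact mem_cosetUnion_firstLeaders hr hqr hm hm0 hK hZ hlt hc
  · rw [hcard, hk]
    push_cast
    ring
  -- Because `h₁ < p`, the dimension is positive; the code is nonzero and its minimum distance is a
  -- genuine minimum.
  · rw [hk]
    have h1 := H.numCosets_mul
    have h2 := Nat.mul_le_mul_right (p ^ (b + 1)) hh
    have h3 : h₁ + p ^ (b + 1) * h < n := by rw [mul_comm _ h]; omega
    zify at h3
    omega

end IsLength

/-! ### Integer forms of the rounded bounds -/

lemma ceil_mul_div_bounds {q : ℕ} (hq : 2 ≤ q) (x : ℤ) :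
    (q : ℤ) * x ≤ ⌈(q : ℚ) * x / ((q : ℚ) - 1)⌉ * ((q : ℤ) - 1) ∧
      ⌈(q : ℚ) * x / ((q : ℚ) - 1)⌉ * ((q : ℤ) - 1) + 2 ≤ q * x + q := by
  have hq1 : (0 : ℚ) < (q : ℚ) - 1 := by
    have : (2 : ℚ) ≤ q := by exact_mod_cast hq
    linarith
  have h1 := Int.le_ceil ((q : ℚ) * x / ((q : ℚ) - 1))
  have h2 := Int.ceil_lt_add_one ((q : ℚ) * x / ((q : ℚ) - 1))
  rw [div_le_iff₀ hq1] at h1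
  rw [← sub_lt_iff_lt_add, lt_div_iff₀ hq1] at h2
  constructor
  · exact_mod_cast h1
  · have : (⌈(q : ℚ) * x / ((q : ℚ) - 1)⌉ - 1) * ((q : ℤ) - 1) < q * x := by exact_mod_cast h2
    linarith

/-- A bound for `⌈K (q - 1) / q⌉`. -/
lemma le_add_div_of_mul_le {q K c : ℕ} (hq : 2 ≤ q) (h : (K : ℤ) * ((q : ℤ) - 1) ≤ q * c) :
    K ≤ c + K / q := by
  have h1 := Nat.div_add_mod K q
  have h2 := Nat.mod_lt K (show 0 < q by omega)
  by_contra! hlt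
  set u := K / q
  set v := K % q
  zify at h1 h2 hlt
  have h3 : (c : ℤ) + 1 ≤ K - u := by omega
  have h4 : (q : ℤ) * (c + 1) ≤ q * (K - u) := mul_le_mul_of_nonneg_left h3 (by positivity)
  nlinarith

lemma ceil_half_bounds (N : ℕ) :
    ⌈(N : ℚ) / 2⌉ = (⌈(N : ℚ) / 2⌉₊ : ℤ) ∧ N ≤ 2 * ⌈(N : ℚ) / 2⌉₊ ∧
      2 * ⌈(N : ℚ) / 2⌉₊ ≤ N + 1 := by
  have h1 := Nat.le_ceil ((N : ℚ) / 2)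
  have h2 := Nat.ceil_lt_add_one (show (0 : ℚ) ≤ (N : ℚ) / 2 by positivity)
  rw [div_le_iff₀ (by norm_num)] at h1
  rw [← sub_lt_iff_lt_add, lt_div_iff₀ (by norm_num)] at h2
  refine ⟨(Int.natCast_ceil_eq_ceil (by positivity)).symm, ?_, ?_⟩
  · have : N ≤ ⌈(N : ℚ) / 2⌉₊ * 2 := by exact_mod_cast h1
    omega
  · have : ⌈(N : ℚ) / 2⌉₊ * 2 < N + 2 := by
      have : (⌈(N : ℚ) / 2⌉₊ : ℚ) * 2 < N + 2 := by linarith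
      exact_mod_cast this
    omega

lemma floor_half (N : ℕ) :
    ⌊(N : ℚ) / 2⌋₊ = N / 2 ∧ ⌊(N : ℚ) / 2⌋ = ((N / 2 : ℕ) : ℤ) := by
  have h : ⌊(N : ℚ) / 2⌋₊ = N / 2 := by
    have := Nat.floor_div_natCast (N : ℚ) 2
    simpa using this
  refine ⟨h, ?_⟩
  rw [← h, Int.natCast_floor_eq_floor (by positivity)]

/-! ### The set `S_m` and the choice of `K` for both codes -/

namespace IsLength

variable {q p r b n : ℕ} (H : IsLength q p r b n)
include H

/-- What membership in `S_m` is used for. -/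
lemma of_mem_S {i j t : ℕ} (h : (i, j, t) ∈ S q n r (p ^ (b + 1))) :
    i < p ^ (b + 1) ∧ 3 ≤ p ^ (b + 1) ∧ 1 ≤ j ∧ j < q ∧
      (q * t + j) * (q ^ (p ^ (b + 1) - i) - 1) + 1 < q ^ i ∧
      q ^ i + (q * t + j) ≡ 1 [MOD r] ∧
      ((q ^ i + (q * t + j) : ℕ) : ℤ) ≤ 1 + (⌈(q : ℚ) *
        (⌈(numCosets q n r (p ^ (b + 1)) : ℚ) / 2⌉ : ℤ) / ((q : ℚ) - 1)⌉ - 2) * (r : ℤ) := by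
  obtain ⟨h1, h2, h3, h4, h5, h6, h7⟩ := h
  have hq := H.two_le
  set m := p ^ (b + 1) with hm
  -- Since `s ≥ 1`, the logarithm is positive, which makes the bound on `i` strict. Together with `m
  -- + 1 ≤ 2 i` this forces `m ≥ 3`.
  have him : i < m := by
    rw [Int.le_floor] at h2
    have hs : (1 : ℝ) ≤ cofactor q n r m := by exact_mod_cast H.cofactor_pos
    have hlog : 0 < Real.logb q ((cofactor q n r m : ℝ) + 1) :=
      Real.logb_pos (by exact_mod_cast hq) (by linarith)
    have : (i : ℝ) < m := by push_cast at h2; linarith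
    exact_mod_cast this
  have hi2 : m + 1 ≤ 2 * i := by
    rw [div_le_iff₀ (by norm_num)] at h1
    have : m + 1 ≤ i * 2 := by exact_mod_cast h1
    omega
  refine ⟨him, by omega, h3, by omega, ?_, by rwa [← add_assoc], by rwa [← add_assoc]⟩
  have hlt : 1 < q ^ (m - i) := Nat.one_lt_pow (by omega) hq
  obtain ⟨c, hc⟩ := Nat.exists_eq_add_of_lt hlt
  have hcq : ((q : ℚ) ^ (m - i)) = c + 2 := by
    have : q ^ (m - i) = c + 2 := by omega
    exact_mod_cast this
  have hq0 : (0 : ℚ) < q := by exact_mod_cast (by omega : 0 < q)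
  rw [pow_succ, hcq, lt_div_iff₀ (by nlinarith [(Nat.cast_nonneg c : (0 : ℚ) ≤ c)])] at h5
  have hc' : q ^ (m - i) - 1 = c + 1 := by omega
  rw [hc']
  have : ((q : ℚ) * t + j) * (c + 1) + 1 < q ^ i := by linarith
  exact_mod_cast this

/-- Since `q t + j < q ^ i`, the exponent `i` is the base-`q` logarithm of the sum. Then `j < q` is
the last digit of the remainder, and `t` is the quotient by `q`. -/
lemma injOn_S : Set.InjOn (fun x : ℕ × ℕ × ℕ => q ^ x.1 + (q * x.2.2 + x.2.1))
    (S q n r (p ^ (b + 1))) := by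
  have hq := H.two_le
  have key : ∀ i j t, (i, j, t) ∈ S q n r (p ^ (b + 1)) →
      Nat.log q (q ^ i + (q * t + j)) = i ∧ j < q := by
    intro i j t h
    obtain ⟨h1, -, -, h4, h5, -⟩ := H.of_mem_S h
    refine ⟨?_, h4⟩
    have hlt : 1 < q ^ (p ^ (b + 1) - i) := Nat.one_lt_pow (by omega) hq
    have hlt2 : q * t + j < q ^ i := by
      have := Nat.le_mul_of_pos_right (q * t + j) (show 0 < q ^ (p ^ (b + 1) - i) - 1 by omega)
      omega
    have h2 : 2 * q ^ i ≤ q ^ (i + 1) := by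
      rw [pow_succ, mul_comm]; exact Nat.mul_le_mul_left _ hq
    exact Nat.log_eq_of_pow_le_of_lt_pow (by omega) (by omega)
  rintro ⟨i, j, t⟩ hx ⟨i', j', t'⟩ hx' h
  simp only at h
  obtain ⟨h1, h2⟩ := key i j t hx
  obtain ⟨h1', h2'⟩ := key i' j' t' hx'
  have hi : i = i' := by rw [← h1, ← h1', h]
  subst hi
  have h3 : q * t + j = q * t' + j' := by omega
  have hj : j = j' := by
    have := congrArg (· % q) h3
    simpa [Nat.add_mod, Nat.mod_eq_of_lt h2, Nat.mod_eq_of_lt h2'] using this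
  subst hj
  have ht : t = t' := Nat.eq_of_mul_eq_mul_left (show 0 < q by omega) (by omega)
  rw [ht]

/-- The elements of `Z_{n,r}` counted by `S_m`. -/
lemma exists_finset_S {N h : ℕ} (hN : numCosets q n r (p ^ (b + 1)) = N)
    (hh : ⌈(N : ℚ) / 2⌉ = (h : ℤ)) (hpos : 0 < (S q n r (p ^ (b + 1))).ncard) :
    3 ≤ p ^ (b + 1) ∧ ∃ A : Finset ℕ, A.card = (S q n r (p ^ (b + 1))).ncard ∧ 1 ∉ A ∧
      (∀ x ∈ A, x ∉ leaders q n r (p ^ (b + 1))) ∧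
      ∀ x ∈ A, ¬ q ∣ x ∧ ∃ k : ℕ, (k : ℤ) < ⌈(q : ℚ) * (h : ℤ) / ((q : ℚ) - 1)⌉ - 1 ∧
        x = 1 + k * r := by
  classical
  have hfin := Set.finite_of_ncard_pos hpos
  obtain ⟨⟨i₀, j₀, t₀⟩, h₀⟩ := (Set.ncard_pos hfin).1 hpos
  refine ⟨(H.of_mem_S h₀).2.1, hfin.toFinset.image fun x => q ^ x.1 + (q * x.2.2 + x.2.1),
    ?_, ?_, ?_, ?_⟩
  · rw [Finset.card_image_of_injOn (by simpa using H.injOn_S), Set.ncard_eq_toFinset_card _ hfin]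
  · rw [Finset.mem_image]
    rintro ⟨⟨i, j, t⟩, hx, h1⟩
    obtain ⟨-, -, hj, -⟩ := H.of_mem_S (hfin.mem_toFinset.1 hx)
    have := Nat.one_le_pow i q (by have := H.two_le; omega)
    simp only at h1
    omega
  · intro x hx
    obtain ⟨⟨i, j, t⟩, hS, rfl⟩ := Finset.mem_image.1 hx
    obtain ⟨hi, -, -, -, hu, -⟩ := H.of_mem_S (hfin.mem_toFinset.1 hS)
    exact H.notMem_leaders_of_lt hi.le hu
  · intro x hx
    obtain ⟨⟨i, j, t⟩, hS, rfl⟩ := Finset.mem_image.1 hx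
    obtain ⟨hi, -, hj, hjq, hu, hmod, hle⟩ := H.of_mem_S (hfin.mem_toFinset.1 hS)
    rw [hN, hh] at hle
    simp only
    constructor
    · intro hd
      have hi0 : i ≠ 0 := by rintro rfl; simp at hu
      rw [← add_assoc, Nat.dvd_add_right (dvd_add (dvd_pow_self q hi0) (dvd_mul_right q t))] at hd
      exact absurd (Nat.le_of_dvd hj hd) (by omega)
    · obtain ⟨k, hk⟩ := (Nat.modEq_iff_dvd' (by omega)).1 hmod.symm
      have hx : q ^ i + (q * t + j) = 1 + k * r := by rw [mul_comm k]; omega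
      refine ⟨k, ?_, hx⟩
      rw [hx] at hle
      push_cast at hle
      have hr : (0 : ℤ) < r := by exact_mod_cast H.r_pos
      push_cast
      have := le_of_mul_le_mul_right ((add_le_add_iff_left 1).1 hle) hr
      linarith

/-- The bounds needed for the code of the first `⌈N_1 / 2⌉` and `⌈N_m / 2⌉` cosets. -/
lemma ceil_bounds {N h K : ℕ} (hN : numCosets q n r (p ^ (b + 1)) = N)
    (hh : ⌈(N : ℚ) / 2⌉ = (h : ℤ)) (hhN : 2 * h ≤ N + 1) (hh0 : 0 < h)
    (hK : K = (⌈(q : ℚ) * (h : ℤ) / ((q : ℚ) - 1)⌉ + Lam q n r (p ^ (b + 1)) - 1).toNat) :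
    2 * K ≤ n ∧ ((leaders q n r (p ^ (b + 1))).filter fun y => y < 1 + K * r).card ≤ h := by
  have hq := H.three_le
  have hNn := H.numCosets_mul
  rw [hN] at hNn
  have hN0 := H.numCosets_pos
  rw [hN] at hN0
  have hm2 := H.one_lt_exponent
  obtain ⟨ha, ha'⟩ := ceil_mul_div_bounds (q := q) (by omega) (h : ℤ)
  obtain ⟨-, hg'⟩ := ceil_mul_div_bounds (q := q) (by omega)
    ((S q n r (p ^ (b + 1))).ncard : ℤ)
  rw [Lam] at hK
  -- If `S_m` has cardinality `0`, then `Λ_m = -1` and `K` is `δ - 2` truncated at `0`.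
  rcases Nat.eq_zero_or_pos (S q n r (p ^ (b + 1))).ncard with hσ | hσ
  · rw [hσ] at hK
    simp only [Nat.cast_zero, mul_zero, zero_div, Int.ceil_zero] at hK
    set δ := ⌈(q : ℚ) * (h : ℤ) / ((q : ℚ) - 1)⌉ with hδ
    have hq1 : (2 : ℤ) ≤ (q : ℤ) - 1 := by omega
    have hKq : (K : ℤ) * ((q : ℤ) - 1) ≤ q * ((h : ℤ) - 1) := by
      rcases le_or_gt 0 (δ - 2) with h0 | h0
      · have : (K : ℤ) = δ - 2 := by omega
        rw [this]; linarith
      · have : (K : ℤ) = 0 := by omega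
        rw [this, zero_mul]
        exact mul_nonneg (by positivity) (by omega)
    constructor
    · have h2N : 2 * N ≤ n := by nlinarith
      zify at h2N hhN hN0 ⊢
      refine le_of_mul_le_mul_right (a := (q : ℤ) - 1) ?_ (by omega)
      nlinarith
    · have h1 := H.card_leaders_add_card_le (K := K) (l := p ^ (b + 1)) (A := ∅) (by simp) (by simp)
      have h2 := le_add_div_of_mul_le (q := q) (K := K) (c := h) (by omega) (by linarith)
      rw [Finset.card_empty] at h1
      omega
  · obtain ⟨hm3, A, hAc, h1A, hAl, hA⟩ := H.exists_finset_S hN hh hσ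
    rw [← hAc] at hK hg' hσ
    set σ := A.card with hσd
    set g := ⌈(q : ℚ) * (σ : ℤ) / ((q : ℚ) - 1)⌉ with hg
    set δ := ⌈(q : ℚ) * (h : ℤ) / ((q : ℚ) - 1)⌉ with hδ
    have hq1 : (2 : ℤ) ≤ (q : ℤ) - 1 := by omega
    have hgpos : 1 ≤ g := by
      rw [hg, Int.one_le_ceil_iff]
      have : (0 : ℚ) < (q : ℚ) - 1 := by
        have : (3 : ℚ) ≤ q := by exact_mod_cast hq
        linarith
      have : (0 : ℚ) < q := by linarith
      have : (0 : ℚ) < σ := by exact_mod_cast hσ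
      push_cast
      positivity
    obtain ⟨x, hx⟩ := Finset.card_pos.1 hσ
    obtain ⟨-, k₀, hk₀, -⟩ := hA x hx
    -- The index `k₀ ≥ 0` of an element of `A` lies below `δ - 1`, so `δ ≥ 2` and the truncation in
    -- `toNat` is harmless.
    have hK' : (K : ℤ) = δ + g - 2 := by
      have : K = (δ + (g - 1) - 1).toNat := hK
      omega
    have hKq : (K : ℤ) * ((q : ℤ) - 1) + 2 ≤ q * ((h : ℤ) + σ) := by
      rw [hK']; linarith
    -- The elements of `A` together with `1` are non-multiples of `q` among the first `δ - 1`
    -- elements of `Z n r`, where at most `h` such numbers exist.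
    have hσh : σ + 1 ≤ h := by
      obtain ⟨K', hK''⟩ := Int.eq_ofNat_of_zero_le (show 0 ≤ δ - 1 by omega)
      have h1 := H.card_le_of_not_dvd (K := K') (A := insert 1 A) (by
        intro x hx
        rcases Finset.mem_insert.1 hx with rfl | hx
        · exact ⟨by rw [Nat.dvd_one]; omega, 0, by omega, by simp⟩
        · obtain ⟨hd, k, hk, e⟩ := hA x hx
          exact ⟨hd, k, by omega, e⟩)
      rw [Finset.card_insert_of_notMem h1A] at h1
      have h2 := le_add_div_of_mul_le (q := q) (K := K') (c := h) (by omega) (by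
        rw [← hK'']; linarith)
      omega
    constructor
    -- Here `m ≥ 3` gives `3 N ≤ n`, and `h + σ ≤ N`; with `q / (q - 1) ≤ 3 / 2` this yields `2 K ≤
    -- n`.
    · have h3N : 3 * N ≤ n := by nlinarith
      zify at h3N hhN hσh ⊢
      refine le_of_mul_le_mul_right (a := (q : ℤ) - 1) ?_ (by omega)
      have h4 : (q : ℤ) * (h + σ) ≤ q * N := mul_le_mul_of_nonneg_left (by omega) (by positivity)
      nlinarith
    · have h1 := H.card_leaders_add_card_le (K := K) (l := p ^ (b + 1)) (A := A)
        (fun x hx => by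
          obtain ⟨hd, k, hk, e⟩ := hA x hx
          exact ⟨hd, k, by omega, e⟩) hAl
      have h2 := le_add_div_of_mul_le (q := q) (K := K) (c := h + σ) (by omega) (by
        push_cast; linarith)
      omega

/-- The bounds needed for the code of the first `⌊N_1 / 2⌋` and `⌊N_m / 2⌋` cosets. -/
lemma floor_bounds {N K : ℕ} (hN : numCosets q n r (p ^ (b + 1)) = N)
    (hK : K = (⌊(q : ℚ) * N / (2 * ((q : ℚ) - 1))⌋ - 1).toNat) :
    p * K ≤ n * (p / 2) ∧
      ((leaders q n r (p ^ (b + 1))).filter fun y => y < 1 + K * r).card ≤ N / 2 := by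
  have hq := H.three_le
  have hNn := H.numCosets_mul
  rw [hN] at hNn
  have hm2 := H.one_lt_exponent
  -- The case `K = 0` absorbs the truncation by `toNat`.
  rcases Nat.eq_zero_or_pos K with h0 | h0
  · rw [h0]
    refine ⟨by simp, ?_⟩
    have : ((leaders q n r (p ^ (b + 1))).filter fun y => y < 1 + 0 * r) = ∅ := by
      rw [Finset.filter_eq_empty_iff]
      intro y hy
      have := bounds_of_mem_Z H.r_pos (mem_leaders.1 hy).1
      omega
    rw [this]
    simp
  have hq1 : (0 : ℚ) < 2 * ((q : ℚ) - 1) := by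
    have : (3 : ℚ) ≤ q := by exact_mod_cast hq
    linarith
  have hKq : 2 * ((K : ℤ) + 1) * ((q : ℤ) - 1) ≤ q * N := by
    have h1 := Int.floor_le ((q : ℚ) * N / (2 * ((q : ℚ) - 1)))
    rw [le_div_iff₀ hq1] at h1
    have h2 : (⌊(q : ℚ) * N / (2 * ((q : ℚ) - 1))⌋ : ℤ) * (2 * ((q : ℤ) - 1)) ≤ q * N := by
      exact_mod_cast h1
    have h3 : (K : ℤ) + 1 = ⌊(q : ℚ) * N / (2 * ((q : ℚ) - 1))⌋ := by omega
    rw [h3]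
    linarith
  have hq1 : (2 : ℤ) ≤ (q : ℤ) - 1 := by omega
  constructor
  -- For `p = 2` the claim is `2 K ≤ n`. For odd `p` the ratio `⌊p / 2⌋ / p` is only known to be at
  -- least `1 / 3`, so `3 K ≤ n` is needed; this follows from `m ≥ 3`.
  · rcases H.prime.eq_two_or_odd' with hp | hp
    · have h2N : 2 * N ≤ n := by nlinarith
      rw [hp]
      have : 2 * K ≤ n := by
        zify at h2N ⊢
        refine le_of_mul_le_mul_right (a := (q : ℤ) - 1) ?_ (by omega)
        nlinarith
      simpa using this
    · obtain ⟨c, hc⟩ := hp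
      have hp2 := H.prime.two_le
      have hm3 : 3 ≤ p ^ (b + 1) := by
        have := Nat.le_self_pow (Nat.succ_ne_zero b) p
        simp only [Nat.succ_eq_add_one] at this
        omega
      have h3N : 3 * N ≤ n := by nlinarith
      have h3K : 3 * K ≤ n := by
        zify at h3N ⊢
        refine le_of_mul_le_mul_right (a := (q : ℤ) - 1) ?_ (by omega)
        nlinarith
      have hp3 : p ≤ 3 * (p / 2) := by omega
      calc p * K ≤ 3 * (p / 2) * K := Nat.mul_le_mul_right _ hp3
        _ = 3 * K * (p / 2) := by ring
        _ ≤ n * (p / 2) := Nat.mul_le_mul_right _ h3K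
  · have h1 := H.card_leaders_add_card_le (K := K) (l := p ^ (b + 1)) (A := ∅) (by simp) (by simp)
    have h2 := le_add_div_of_mul_le (q := q) (K := K) (c := N / 2) (by omega) (by
      have hN2 : (N : ℤ) ≤ 2 * ((N / 2 : ℕ) : ℤ) + 1 := by omega
      have : (q : ℤ) * N ≤ q * (2 * ((N / 2 : ℕ) : ℤ) + 1) :=
        mul_le_mul_of_nonneg_left hN2 (by positivity)
      linarith)
    rw [Finset.card_empty] at h1
    omega

/-! ### Parameters of the two codes and existence of the roots -/

lemma cast_numCosets : ((n : ℚ) - p) / (p : ℚ) ^ (b + 1) = numCosets q n r (p ^ (b + 1)) := by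
  have hp : (p : ℚ) ≠ 0 := by exact_mod_cast H.prime.ne_zero
  rw [div_eq_iff (pow_ne_zero _ hp)]
  have : (numCosets q n r (p ^ (b + 1)) : ℚ) * (p : ℚ) ^ (b + 1) + p = n := by
    exact_mod_cast H.numCosets_mul
  linarith

lemma cast_numCosets_div_two : ((n : ℚ) - p) / (2 * (p : ℚ) ^ (b + 1))
    = (numCosets q n r (p ^ (b + 1)) : ℚ) / 2 := by
  rw [← H.cast_numCosets, div_div, mul_comm]

variable {F : Type*} [Field F] [Finite F] {β : AlgebraicClosure F} {a : F}

lemma generates_ceil (hq : Nat.card F = q) (hβ : IsPrimitiveRoot β (n * r))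
    (ha : algebraMap F (AlgebraicClosure F) a = β ^ n) :
    Generates q n r a β (ceilLeaders q n r 1 (p ^ (b + 1)))
      ((n : ℤ) - ⌈(p : ℚ) / 2⌉
        - (p : ℤ) ^ (b + 1) * ⌈((n : ℚ) - p) / (2 * (p : ℚ) ^ (b + 1))⌉)
      (⌈(q : ℚ) * (⌈((n : ℚ) - p) / (2 * (p : ℚ) ^ (b + 1))⌉ : ℤ) / ((q : ℚ) - 1)⌉
        + Lam q n r (p ^ (b + 1))) := by
  rw [H.cast_numCosets_div_two, ceilLeaders, H.numCosets_one]
  obtain ⟨e1, hp1, hp2⟩ := ceil_half_bounds p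
  obtain ⟨e2, hN1, hN2⟩ := ceil_half_bounds (numCosets q n r (p ^ (b + 1)))
  have hN0 := H.numCosets_pos
  have hpp := H.prime.two_le
  obtain ⟨h1, h2⟩ := H.ceil_bounds rfl e2 hN2 (by omega) rfl
  refine H.generates_firstLeaders hq hβ ha (by omega) (by omega) ?_ h2 (by rw [e1, e2]) ?_
  -- Combine `2 K ≤ n` with `p ≤ 2 ⌈p / 2⌉`.
  · have h3 := Nat.mul_le_mul_right p h1
    have h4 := Nat.mul_le_mul_left n hp1
    linarith
  · rw [e2]
    exact le_trans (by linarith) (add_le_add_left (Int.self_le_toNat _) 1)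

lemma generates_floor (hq : Nat.card F = q) (hβ : IsPrimitiveRoot β (n * r))
    (ha : algebraMap F (AlgebraicClosure F) a = β ^ n) :
    Generates q n r a β (floorLeaders q n r 1 (p ^ (b + 1)))
      ((n : ℤ) - ⌊(p : ℚ) / 2⌋
        - (p : ℤ) ^ (b + 1) * ⌊((n : ℚ) - p) / (2 * (p : ℚ) ^ (b + 1))⌋)
      ⌊(q : ℚ) * ((n : ℚ) - p) / (2 * (p : ℚ) ^ (b + 1) * ((q : ℚ) - 1))⌋ := by
  have hd : (q : ℚ) * ((n : ℚ) - p) / (2 * (p : ℚ) ^ (b + 1) * ((q : ℚ) - 1))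
      = (q : ℚ) * numCosets q n r (p ^ (b + 1)) / (2 * ((q : ℚ) - 1)) := by
    rw [← H.cast_numCosets, mul_div_assoc', div_div]
    congr 1
    ring
  rw [hd, H.cast_numCosets_div_two, floorLeaders, H.numCosets_one, (floor_half p).1,
    (floor_half p).2, (floor_half (numCosets q n r (p ^ (b + 1)))).1,
    (floor_half (numCosets q n r (p ^ (b + 1)))).2]
  have hpp := H.prime.two_le
  obtain ⟨h1, h2⟩ := H.floor_bounds rfl rfl
  refine H.generates_firstLeaders hq hβ ha (by omega) (by omega) h1 h2 rfl ?_
  exact le_trans (by linarith) (add_le_add_left (Int.self_le_toNat _) 1)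

/-- As `n r` divides `q ^ m - 1`, which is `-1` in `F`, it is nonzero in `F`. -/
lemma exists_isPrimitiveRoot (hq : Nat.card F = q) :
    ∃ β : AlgebraicClosure F, IsPrimitiveRoot β (n * r) := by
  have hFq : (q : F) = 0 := by
    have := Fintype.ofFinite F
    rw [← hq, Nat.card_eq_fintype_card, FiniteField.cast_card_eq_zero]
  have hne : ((n * r : ℕ) : F) ≠ 0 := by
    intro h0
    have h := congrArg (Nat.cast (R := F)) H.mul_cofactor
    rw [Nat.cast_mul, h0, zero_mul,
      Nat.cast_sub (Nat.one_le_pow _ _ (by have := H.two_le; omega))] at h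
    rw [Nat.cast_pow, hFq, zero_pow H.exponent_pos.ne', Nat.cast_one, zero_sub, eq_comm,
      neg_eq_zero] at h
    exact one_ne_zero h
  have : NeZero ((n * r : ℕ) : AlgebraicClosure F) := ⟨by
    rw [← map_natCast (algebraMap F (AlgebraicClosure F)), Ne, map_eq_zero]
    exact hne⟩
  exact HasEnoughRootsOfUnity.exists_primitiveRoot (AlgebraicClosure F) (n * r)

/-- The order `r` of `β ^ n` divides `q - 1`, so `β ^ n` is fixed by the `q`-th power map and lies
in `F`. -/
lemma exists_shift_constant (hq : Nat.card F = q) (hβ : IsPrimitiveRoot β (n * r)) :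
    ∃ a : F, algebraMap F (AlgebraicClosure F) a = β ^ n ∧ orderOf a = r := by
  have hprim : IsPrimitiveRoot (β ^ n) r := hβ.pow H.mul_pos rfl
  obtain ⟨a, ha⟩ := exists_algebraMap_eq_of_pow_card (F := F) (c := β ^ n) (by
    rw [hq]
    conv_rhs => rw [← pow_one (β ^ n)]
    exact pow_eq_pow_of_modEq H.modEq_one hprim.pow_eq_one)
  refine ⟨a, ha, ?_⟩
  rw [← ha] at hprim
  exact (IsPrimitiveRoot.of_map_of_injective hprim
    (algebraMap F (AlgebraicClosure F)).injective).eq_orderOf.symm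

end IsLength

lemma eval_cyclotomic_prime_pow {p : ℕ} (hp : p.Prime) (q b : ℕ) :
    (Polynomial.cyclotomic (p ^ (b + 1)) ℤ).eval (q : ℤ)
      = ((∑ j ∈ Finset.range p, (q ^ p ^ b) ^ j : ℕ) : ℤ) := by
  rw [cyclotomic_prime_pow_eq_geom_sum hp]
  simp [eval_finsetSum]

/-- The lengths exceed every bound, so infinitely many occur. -/
lemma lt_geom_sum {p q : ℕ} (hp : p.Prime) (hq : 2 ≤ q) (b : ℕ) :
    b < ∑ j ∈ Finset.range p, (q ^ p ^ b) ^ j :=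
  calc b < p ^ b := Nat.lt_pow_self hp.one_lt
    _ < q ^ p ^ b := Nat.lt_pow_self (by omega)
    _ = (q ^ p ^ b) ^ 1 := (pow_one _).symm
    _ ≤ _ := Finset.single_le_sum (f := fun j => (q ^ p ^ b) ^ j) (fun _ _ => Nat.zero_le _)
      (Finset.mem_range.2 hp.one_lt)

end Constacyclic

end

theorem theorem6 {F : Type*} [Field F] [Finite F] (q p r : ℕ) (hq : Nat.card F = q)
    (hp : p.Prime) (hr : r ∣ q - 1) (hpr : p ∣ (q - 1) / r) :
    {n : ℕ | ∃ b : ℕ, 1 ≤ b ∧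
      (n : ℤ) = (Polynomial.cyclotomic (p ^ b) ℤ).eval (q : ℤ)}.Infinite ∧
    ∀ b n : ℕ, 1 ≤ b → (n : ℤ) = (Polynomial.cyclotomic (p ^ b) ℤ).eval (q : ℤ) →
      n * r * Constacyclic.cofactor q n r (p ^ b) = q ^ p ^ b - 1 ∧
      {l : ℕ | ∃ i ∈ Constacyclic.Z n r, (Constacyclic.coset q (n * r) i).card = l} = {1, p ^ b} ∧
      Constacyclic.numCosets q n r 1 = p ∧
      (Constacyclic.numCosets q n r (p ^ b) : ℚ) = ((n : ℚ) - p) / (p : ℚ) ^ b ∧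
      (∃ β : AlgebraicClosure F, IsPrimitiveRoot β (n * r)) ∧
      ∀ β : AlgebraicClosure F, IsPrimitiveRoot β (n * r) →
        ∃ a : F, algebraMap F (AlgebraicClosure F) a = β ^ n ∧ orderOf a = r ∧
          Constacyclic.Generates q n r a β (Constacyclic.ceilLeaders q n r 1 (p ^ b))
            ((n : ℤ) - ⌈(p : ℚ) / 2⌉ - (p : ℤ) ^ b * ⌈((n : ℚ) - p) / (2 * (p : ℚ) ^ b)⌉)
            (⌈(q : ℚ) * (⌈((n : ℚ) - p) / (2 * (p : ℚ) ^ b)⌉ : ℤ) / ((q : ℚ) - 1)⌉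
              + Constacyclic.Lam q n r (p ^ b)) ∧
          (r ≤ 3 ∨ q * r ≤ 2 * p ^ b * (q - 1) →
            Constacyclic.Generates q n r a β (Constacyclic.floorLeaders q n r 1 (p ^ b))
              ((n : ℤ) - ⌊(p : ℚ) / 2⌋ - (p : ℤ) ^ b * ⌊((n : ℚ) - p) / (2 * (p : ℚ) ^ b)⌋)
              ⌊(q : ℚ) * ((n : ℚ) - p) / (2 * (p : ℚ) ^ b * ((q : ℚ) - 1))⌋) := by
  have hq2 : 2 ≤ q := by
    rw [← hq]
    exact Finite.one_lt_card
  refine ⟨?_, ?_⟩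
  · refine Set.infinite_of_forall_exists_gt fun c => ?_
    exact ⟨_, ⟨c + 1, Nat.le_add_left _ _, (Constacyclic.eval_cyclotomic_prime_pow hp q c).symm⟩,
      Constacyclic.lt_geom_sum hp hq2 c⟩
  · intro b n hb hn
    obtain ⟨b, rfl⟩ := Nat.exists_eq_add_of_le' hb
    rw [Constacyclic.eval_cyclotomic_prime_pow hp] at hn
    have H : Constacyclic.IsLength q p r b n := ⟨hp, hq2, hr, hpr, by exact_mod_cast hn⟩
    refine ⟨H.mul_cofactor, H.setOf_card_coset, H.numCosets_one, H.cast_numCosets.symm,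
      H.exists_isPrimitiveRoot hq, fun β hβ => ?_⟩
    obtain ⟨a, ha, har⟩ := H.exists_shift_constant hq hβ
    exact ⟨a, ha, har, H.generates_ceil hq hβ ha, fun _ => H.generates_floor hq hβ ha⟩
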